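/- Let $x_0<x_1<\dots<x_m$ and $y_0<y_1<\dots<y_n$ ($m,n\ge 1$) be real numbers, $\Omega=[x_0,x_m]\times[y_0,y_n]$, and let $\mathcal T_{mn}$ be the criss-cross triangulation of $\Omega$, obtained by drawing both diagonals in every subrectangle $[x_{i-1},x_i]\times[y_{j-1},y_j]$. Repeat the end knots ($x_i=x_0$ for $i<0$, $x_i=x_m$ for $i>m$, and likewise for $y$), and put $h_i=x_i-x_{i-1}$, $k_j=y_j-y_{j-1}$, $s_i=\frac12(x_{i-1}+x_i)$, $t_j=\frac12(y_{j-1}+y_j)$, $A_{i,j}=(x_i,y_j)$, $M_{i,j}=(s_i,t_j)$, $h=\max\{h_i,k_j: 1\le i\le m,\,1\le j\le n\}$, $\delta=\min\{h_i,k_j: 1\le i\le m,\,1\le j\le n\}$. For $1\le i\le m+1$ put $\sigma_i=\frac{h_i}{h_{i-1}+h_i}$, $\sigma_i'=1-\sigma_i$, and for $1\le j\le n+1$ put $\tau_j=\frac{k_j}{k_{j-1}+k_j}$, $\tau_j'=1-\tau_j$. For $0\le i\le m+1$, $0\le j\le n+1$, let $B_{ij}$ be the $C^1$ quadratic B-spline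 on $\mathcal T_{mn}$ (with support in $\Omega$), i.e. the piecewise quadratic function whose Bernstein–Bézier coefficients are as follows. With $v_k(i)=\sigma_{k+1}$ if $i=k$, $v_k(i)=\sigma'_{k+1}$ if $i=k+1$, $v_k(i)=0$ otherwise, and $w_l(j)$ defined in the same way from $\tau,\tau'$: the coefficient is $v_k(i)w_l(j)$ at the vertex $A_{k,l}$; $v_k(i)\,[j=s]$ at the midpoint $(x_k,t_s)$ of a vertical edge; $[i=r]\,w_l(j)$ at the midpoint $(s_r,y_l)$ of a horizontal edge; the average of the coefficients at $(x_k,t_s)$ and $(s_r,y_l)$ at the midpoint of the segment from $M_{r,s}$ to a corner $A_{k,l}$ of its subrectangle; and the average of the four edge-midpoint coefficients at the centre $M_{r,s}$. (Here $[\cdot]$ is $1$ if the condition holds and $0$ otherwise.) Let $a_i=-\frac{\sigma_i^2\sigma_{i+1}'}{\sigma_i+\sigma_{i+1}'}$, $c_i=-\frac{\sigma_i(\sigma_{i+1}')^2}{\sigma_i+\sigma_{i+1}'}$ for $1\le i\le m$, $\bar a_j=-\frac{\tau_j^2\tau_{j+1}'}{\tau_j+\tau_{j+1}'}$, $\bar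 c_j=-\frac{\tau_j(\tau_{j+1}')^2}{\tau_j+\tau_{j+1}'}$ for $1\le j\le n$, and $a_0=c_0=a_{m+1}=c_{m+1}=\bar a_0=\bar c_0=\bar a_{n+1}=\bar c_{n+1}=0$, $b_{ij}=1-(a_i+c_i+\bar a_j+\bar c_j)$. The quasi-interpolants $S_2$ and $W_2^*$ are $$S_2f=\sum_{i=0}^{m+1}\sum_{j=0}^{n+1}\mu_{ij}(f)B_{ij},\qquad W_2^*f=\sum_{i=0}^{m+1}\sum_{j=0}^{n+1}\mu^*_{ij}(f)B_{ij},$$ $$\mu_{ij}(f)=b_{ij}f(M_{i,j})+a_if(M_{i-1,j})+c_if(M_{i+1,j})+\bar a_jf(M_{i,j-1})+\bar c_jf(M_{i,j+1}),$$ $$\mu^*_{ij}(f)=2f(M_{i,j})-\tfrac14\left[f(A_{i-1,j-1})+f(A_{i-1,j})+f(A_{i,j-1})+f(A_{i,j})\right].$$ Write $\|\cdot\|_\Omega$ for the supremum norm over $\Omega$, $\omega(\psi,t)=\max\{|\psi(M)-\psi(P)|: M,P\in\Omega,\ \|M-P\|\le t\}$ (Euclidean norm), and $\omega(Df,t)=\max_{|\alpha|=1}\omega(D^\alpha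 f,t)$. **Theorem 4.** Let $Q=S_2$ or $Q=W_2^*$. There is a constant $\overline C_1>0$, independent of the partitions, of $f$ and of $\alpha$, with $\overline C_1\le 120$ for $Q=S_2$ and $\overline C_1\le 70$ for $Q=W_2^*$, such that for all partitions as above and all $f\in C^1(\Omega)$ one has $Qf\in C^1(\Omega)$ and, for $|\alpha|=1$, $$\|D^\alpha f-D^\alpha Qf\|_\Omega\le\left[1+\overline C_1\,\frac h\delta\right]\omega\!\left(Df,\frac h2\right).$$ -/

import Mathlib

noncomputable section

namespace CrissCross

/-- A partition `x_0 < x_1 < ... < x_m` (with `m ≥ 1`) of the segment `[x_0, x_m]`. -/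
structure Knots where
  m : ℕ
  m_pos : 0 < m
  pt : Fin (m + 1) → ℝ
  strictMono_pt : StrictMono pt

namespace Knots

variable (X : Knots)

/-- The knots indexed by `ℤ`, the end knots being repeated:
`x_i = x_0` for `i ≤ 0` and `x_i = x_m` for `i ≥ m`. -/
def knot (i : ℤ) : ℝ := X.pt ⟨min i.toNat X.m, by omega⟩

/-- The segment `[x_0, x_m]`. -/
def segment : Set ℝ := Set.Icc (X.knot 0) (X.knot X.m)

/-- `h_i = x_i - x_{i-1}`; in particular `h_0 = h_{m+1} = 0`. -/
def step (i : ℤ) : ℝ := X.knot i - X.knot (i - 1)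

/-- `s_i = (x_{i-1} + x_i) / 2`. -/
def mid (i : ℤ) : ℝ := (X.knot (i - 1) + X.knot i) / 2

/-- `σ_i = h_i / (h_{i-1} + h_i)`, used for `1 ≤ i ≤ m + 1`
(so `σ_1 = 1` and `σ_{m+1} = 0`). -/
def ratio (i : ℤ) : ℝ := X.step i / (X.step (i - 1) + X.step i)

/-- `σ'_i = h_{i-1} / (h_{i-1} + h_i)`, used for `1 ≤ i ≤ m + 1`
(so `σ'_1 = 0` and `σ'_{m+1} = 1`). -/
def ratio' (i : ℤ) : ℝ := X.step (i - 1) / (X.step (i - 1) + X.step i)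

lemma nonempty_steps : (Finset.Icc (1 : ℤ) X.m).Nonempty :=
  Finset.nonempty_Icc.2 (by have := X.m_pos; omega)

/-- The largest of `h_1, ..., h_m`. -/
def maxStep : ℝ := (Finset.Icc (1 : ℤ) X.m).sup' X.nonempty_steps X.step

/-- The smallest of `h_1, ..., h_m`. -/
def minStep : ℝ := (Finset.Icc (1 : ℤ) X.m).inf' X.nonempty_steps X.step

/-- `a_i = -σ_i² σ'_{i+1} / (σ_i + σ'_{i+1})` for `1 ≤ i ≤ m`, and `a_0 = a_{m+1} = 0`. -/
def coefA (i : ℤ) : ℝ :=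
  if 1 ≤ i ∧ i ≤ X.m then
    -(X.ratio i ^ 2 * X.ratio' (i + 1)) / (X.ratio i + X.ratio' (i + 1))
  else 0

/-- `c_i = -σ_i (σ'_{i+1})² / (σ_i + σ'_{i+1})` for `1 ≤ i ≤ m`, and `c_0 = c_{m+1} = 0`. -/
def coefC (i : ℤ) : ℝ :=
  if 1 ≤ i ∧ i ≤ X.m then
    -(X.ratio i * X.ratio' (i + 1) ^ 2) / (X.ratio i + X.ratio' (i + 1))
  else 0

/-- The value at the knot `x_k` (`0 ≤ k ≤ m`) of the `i`-th (`0 ≤ i ≤ m + 1`) univariate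
quadratic B-spline on the knots `x_{i-2}, x_{i-1}, x_i, x_{i+1}`. -/
def knotValue (k i : ℤ) : ℝ :=
  if i = k then X.ratio (k + 1) else if i = k + 1 then X.ratio' (k + 1) else 0

/-- For `t` in the segment, an index `r` in `1, ..., m` with `t ∈ [x_{r-1}, x_r]`:
`t ∈ (x_{r-1}, x_r]` if `t > x_0`, and `r = 1` if `t = x_0`. -/
def cell (t : ℝ) : ℤ := max 1 ({k : Fin (X.m + 1) | X.pt k < t} : Finset _).card

/-- The affine coordinate on `[x_{r-1}, x_r]` with values in `[-1, 1]`. -/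
def localCoord (r : ℤ) (t : ℝ) : ℝ := (t - X.mid r) / (X.step r / 2)

end Knots

/-- The quadratic Bernstein-Bezier form on the criss-cross triangulation of the square
`[-1, 1]²` (two diagonals drawn). The corners are indexed by `Bool × Bool`
(`true` for the coordinate `1`, `false` for the coordinate `-1`). At `(u, v)`, the numbers `w0`
and `w p q` below are the barycentric coordinates with respect to the centre and to the two
corners of the triangle containing `(u, v)`; they vanish at the other two corners.
The coefficients are: `c p q` at the corners; `dv p` at the midpoints of the two vertical sides;
`dh q` at the midpoints of the two horizontal sides; `e p q` at the midpoints of the segments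
from the centre to the corners; `z` at the centre. -/
def bbForm (c : Bool → Bool → ℝ) (dv dh : Bool → ℝ) (e : Bool → Bool → ℝ) (z : ℝ)
    (u v : ℝ) : ℝ :=
  let sgn : Bool → ℝ := fun p => if p then 1 else -1
  let w0 : ℝ := 1 - max |u| |v|
  let w : Bool → Bool → ℝ := fun p q => max (sgn p * u + sgn q * v) 0 / 2
  z * w0 ^ 2 + (∑ p, ∑ q, c p q * w p q ^ 2) + 2 * w0 * (∑ p, ∑ q, e p q * w p q)
    + 2 * (∑ p, dv p * (w p true * w p false)) + 2 * (∑ q, dh q * (w true q * w false q))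

/-- The restriction to the subrectangle `[x_{r-1}, x_r] × [y_{s-1}, y_s]` of the B-spline
`B_ij`, given by its Bernstein-Bezier coefficients there. -/
def bsplineCell (X Y : Knots) (i j r s : ℤ) (p : ℝ × ℝ) : ℝ :=
  -- index of the right / left vertical line and of the upper / lower horizontal line
  let kx : Bool → ℤ := fun b => if b then r else r - 1
  let ky : Bool → ℤ := fun b => if b then s else s - 1
  let dv : Bool → ℝ := fun b => X.knotValue (kx b) i * (if j = s then 1 else 0)
  let dh : Bool → ℝ := fun b => (if i = r then 1 else 0) * Y.knotValue (ky b) j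
  bbForm (fun b b' => X.knotValue (kx b) i * Y.knotValue (ky b') j) dv dh
    (fun b b' => (dv b + dh b') / 2) ((dv true + dv false + dh true + dh false) / 4)
    (X.localCoord r p.1) (Y.localCoord s p.2)

/-- The quadratic B-spline `B_ij`, `0 ≤ i ≤ m + 1`, `0 ≤ j ≤ n + 1`, of the criss-cross
triangulation, with support in the rectangle. (Values outside the rectangle play no role.) -/
def bspline (X Y : Knots) (i j : ℤ) (p : ℝ × ℝ) : ℝ :=
  bsplineCell X Y i j (X.cell p.1) (Y.cell p.2) p

/-- The rectangle `Ω = [x_0, x_m] × [y_0, y_n]`. -/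
def domain (X Y : Knots) : Set (ℝ × ℝ) := X.segment ×ˢ Y.segment

/-- `h = max {h_i, k_j}`. -/
def meshMax (X Y : Knots) : ℝ := max X.maxStep Y.maxStep

/-- `δ = min {h_i, k_j}`. -/
def meshMin (X Y : Knots) : ℝ := min X.minStep Y.minStep

/-- The point `M_ij = (s_i, t_j)`. -/
def siteM (X Y : Knots) (i j : ℤ) : ℝ × ℝ := (X.mid i, Y.mid j)

/-- The point `A_ij = (x_i, y_j)`; because the end knots are repeated, it is in the rectangle
for all `i` and `j`. -/
def siteA (X Y : Knots) (i j : ℤ) : ℝ × ℝ := (X.knot i, Y.knot j)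

/-- The coefficient functional `μ_ij` of `S_2`. -/
def muS (X Y : Knots) (f : ℝ × ℝ → ℝ) (i j : ℤ) : ℝ :=
  (1 - (X.coefA i + X.coefC i + Y.coefA j + Y.coefC j)) * f (siteM X Y i j)
    + X.coefA i * f (siteM X Y (i - 1) j) + X.coefC i * f (siteM X Y (i + 1) j)
    + Y.coefA j * f (siteM X Y i (j - 1)) + Y.coefC j * f (siteM X Y i (j + 1))

/-- The coefficient functional `μ*_ij` of `W_2*`. -/
def muW (X Y : Knots) (f : ℝ × ℝ → ℝ) (i j : ℤ) : ℝ :=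
  2 * f (siteM X Y i j) - 1 / 4 * (f (siteA X Y (i - 1) (j - 1)) + f (siteA X Y (i - 1) j)
    + f (siteA X Y i (j - 1)) + f (siteA X Y i j))

/-- The quasi-interpolant `S_2`. -/
def opS (X Y : Knots) (f : ℝ × ℝ → ℝ) (p : ℝ × ℝ) : ℝ :=
  ∑ i ∈ Finset.Icc (0 : ℤ) (X.m + 1), ∑ j ∈ Finset.Icc (0 : ℤ) (Y.m + 1),
    muS X Y f i j * bspline X Y i j p

/-- The quasi-interpolant `W_2*`. -/
def opW (X Y : Knots) (f : ℝ × ℝ → ℝ) (p : ℝ × ℝ) : ℝ :=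
  ∑ i ∈ Finset.Icc (0 : ℤ) (X.m + 1), ∑ j ∈ Finset.Icc (0 : ℤ) (Y.m + 1),
    muW X Y f i j * bspline X Y i j p

/-- The partial derivative `D^α g`, `α = (α_1, α_2)`, on the rectangle
(one-sided on its boundary). -/
def partialD (X Y : Knots) (α : ℕ × ℕ) (g : ℝ × ℝ → ℝ) (p : ℝ × ℝ) : ℝ :=
  iteratedDerivWithin α.1
    (fun x => iteratedDerivWithin α.2 (fun y => g (x, y)) Y.segment p.2) X.segment p.1

/-- The modulus of continuity `ω(ψ, t)` of `ψ` on the rectangle (Euclidean distance). -/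
def modulus (X Y : Knots) (ψ : ℝ × ℝ → ℝ) (t : ℝ) : ℝ :=
  sSup {d : ℝ | ∃ M ∈ domain X Y, ∃ P ∈ domain X Y,
    Real.sqrt ((M.1 - P.1) ^ 2 + (M.2 - P.2) ^ 2) ≤ t ∧ d = |ψ M - ψ P|}

/-- `ω(D^s f, t) = max {ω(D^α f, t) : |α| = s}`. -/
def modulusD (X Y : Knots) (s : ℕ) (f : ℝ × ℝ → ℝ) (t : ℝ) : ℝ :=
  (Finset.HasAntidiagonal.antidiagonal s).sup' ⟨(0, s), by simp⟩ (fun α => modulus X Y (partialD X Y α f) t)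

/-- The error bound with constant `C`, for the quasi-interpolation operators `Q` (one for each
pair of partitions): for every `f ∈ C¹(Ω)`, `Q f ∈ C¹(Ω)` and
`‖D^α f - D^α (Q f)‖_Ω ≤ (1 + C h / δ) ω(Df, h / 2)` for `|α| = 1`, with the supremum norm
over `Ω`. -/
def FirstDerivativeBound (Q : Knots → Knots → (ℝ × ℝ → ℝ) → ℝ × ℝ → ℝ) (C : ℝ) : Prop :=
  ∀ (X Y : Knots) (f : ℝ × ℝ → ℝ), ContDiffOn ℝ 1 f (domain X Y) →
    ContDiffOn ℝ 1 (Q X Y f) (domain X Y) ∧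
    ∀ α : ℕ × ℕ, α.1 + α.2 = 1 → ∀ p ∈ domain X Y,
      |partialD X Y α f p - partialD X Y α (Q X Y f) p| ≤
        (1 + C * (meshMax X Y / meshMin X Y)) * modulusD X Y 1 f (meshMax X Y / 2)

end CrissCross

end

noncomputable section

namespace CrissCross

/-! ### Knots, steps, ratios and the coefficients `coefA`, `coefC` -/

namespace Knots

variable (X : Knots)

/-! Both operators are splines whose B-spline coefficients φ_ij are local functionals of f, so two
facts suffice: every such spline is C¹, and its x-derivative is governed by divided differences of
φ.

Smoothness. On a subrectangle the Bernstein-Bézier form is one quadratic polynomial plus multiples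
of squared positive parts vanishing on half-planes bounded by the diagonals
(`bbForm_eq_squareForm`), hence C¹. Across a mesh line the one-sided slopes agree because the value
at a knot divides the two neighbouring coefficients in the ratio of the adjacent steps
(`cell_eq_succ`). The pieces are then glued along a finite closed cover
(`hasFDerivWithinAt_iUnion_of_isClosed`).

Estimate. The x-derivative is affine on each triangle, so it is a convex combination of its values
at the centre and the corners, and these are convex combinations of the quotients (φ_ij - φ_{i-1,j})
/ (s_i - s_{i-1}) of nearby indices (`abs_cellGradX_sub_le`). Fix p in a subrectangle and let F be
the x-derivative of f at p. By the mean value theorem all horizontal difference quotients of f near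
the subrectangle are within K = 9 ω(Df, h/2) of F (`slopeNear_partialD`). The quotients of φ are
then within 3K of F for W_2* (`SlopeNear.abs_muW_sub_le`) and within 9K for S_2
(`SlopeNear.abs_muS_sub_le`).

This gives the errors 27 ω and 81 ω with no mesh ratio at all; h/δ ≥ 1 turns them into the stated
form with constants 26 and 80. The y-derivative follows by exchanging the coordinates. -/

lemma knot_natCast {k : ℕ} (hk : k ≤ X.m) : X.knot k = X.pt ⟨k, by omega⟩ := by
  unfold knot
  congr 1
  ext
  simp [hk]

lemma knot_mono : Monotone X.knot := by
  intro i j hij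
  refine X.strictMono_pt.monotone ?_
  simp only [Fin.mk_le_mk]
  omega

lemma knot_sub_one_lt {i : ℤ} (h1 : 1 ≤ i) (h2 : i ≤ X.m) : X.knot (i - 1) < X.knot i := by
  refine X.strictMono_pt ?_
  simp only [Fin.mk_lt_mk]
  omega

lemma knot_of_nonpos {i : ℤ} (h : i ≤ 0) : X.knot i = X.knot 0 := by
  unfold knot
  congr 1
  ext
  simp [Int.toNat_of_nonpos h]

lemma knot_of_ge {i : ℤ} (h : X.m ≤ i) : X.knot i = X.knot X.m := by
  unfold knot
  congr 1
  ext
  simp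
  omega

lemma knot_mem_segment (i : ℤ) : X.knot i ∈ X.segment := by
  constructor
  · rcases le_total i 0 with h | h
    · rw [X.knot_of_nonpos h]
    · exact X.knot_mono h
  · rcases le_total (X.m : ℤ) i with h | h
    · rw [X.knot_of_ge h]
    · exact X.knot_mono h

lemma knot_zero_lt : X.knot 0 < X.knot X.m :=
  X.strictMono_pt (Fin.mk_lt_mk.2 (by simpa using X.m_pos))

lemma step_nonneg (i : ℤ) : 0 ≤ X.step i :=
  sub_nonneg.2 (X.knot_mono (by omega))

lemma step_pos {i : ℤ} (h1 : 1 ≤ i) (h2 : i ≤ X.m) : 0 < X.step i :=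
  sub_pos.2 (X.knot_sub_one_lt h1 h2)

lemma step_le_maxStep (i : ℤ) : X.step i ≤ X.maxStep := by
  by_cases h : 1 ≤ i ∧ i ≤ X.m
  · exact Finset.le_sup' X.step (Finset.mem_Icc.2 h)
  · have h0 : X.step i = 0 := by
      rw [step, sub_eq_zero]
      rcases not_and_or.1 h with h | h
      · rw [X.knot_of_nonpos (by omega), X.knot_of_nonpos (i := i - 1) (by omega)]
      · rw [X.knot_of_ge (by omega), X.knot_of_ge (i := i - 1) (by omega)]
    have h1 : (1 : ℤ) ≤ X.m := by have := X.m_pos; omega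
    exact h0.le.trans ((X.step_nonneg 1).trans
      (Finset.le_sup' X.step (Finset.mem_Icc.2 ⟨le_rfl, h1⟩)))

lemma minStep_pos : 0 < X.minStep :=
  (Finset.lt_inf'_iff _).2 fun _ hi =>
    X.step_pos (Finset.mem_Icc.1 hi).1 (Finset.mem_Icc.1 hi).2

lemma minStep_le_maxStep : X.minStep ≤ X.maxStep := by
  have h1 : (1 : ℤ) ≤ X.m := by have := X.m_pos; omega
  exact (Finset.inf'_le X.step (Finset.mem_Icc.2 ⟨le_rfl, h1⟩)).trans (X.step_le_maxStep 1)

lemma knot_sub_one_le_mid (i : ℤ) : X.knot (i - 1) ≤ X.mid i := by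
  have := X.knot_mono (show i - 1 ≤ i by omega)
  unfold mid
  linarith

lemma mid_le_knot (i : ℤ) : X.mid i ≤ X.knot i := by
  have := X.knot_mono (show i - 1 ≤ i by omega)
  unfold mid
  linarith

/-- The distance `s_i - s_{i-1}` of consecutive midpoints. -/
def gap (i : ℤ) : ℝ := X.mid i - X.mid (i - 1)

lemma gap_eq (i : ℤ) : X.gap i = (X.step (i - 1) + X.step i) / 2 := by
  unfold gap mid step
  ring

lemma knot_sub_knot_sub_two (i : ℤ) : X.knot i - X.knot (i - 2) = 2 * X.gap i := by
  rw [gap_eq, step, step, show i - 1 - 1 = i - 2 by ring]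
  ring

lemma gap_nonneg (i : ℤ) : 0 ≤ X.gap i := by
  rw [gap_eq]
  have := X.step_nonneg (i - 1)
  have := X.step_nonneg i
  linarith

lemma mid_mono : Monotone X.mid :=
  monotone_int_of_le_succ fun i => by
    have := X.gap_nonneg (i + 1)
    rw [gap, add_sub_cancel_right] at this
    linarith

/-- Stated for every index: where both steps vanish beyond the repeated end knots, the quotient 0/0
is 0 and both sides are 0. -/
lemma ratio_mul_gap (i : ℤ) : X.ratio i * X.gap i = X.step i / 2 := by
  have h1 := X.step_nonneg (i - 1)
  have h2 := X.step_nonneg i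
  rw [ratio, gap_eq]
  by_cases h : X.step (i - 1) + X.step i = 0
  · rw [h]
    have : X.step i = 0 := by linarith
    simp [this]
  · field_simp

lemma ratio'_mul_gap (i : ℤ) : X.ratio' i * X.gap i = X.step (i - 1) / 2 := by
  have h1 := X.step_nonneg (i - 1)
  have h2 := X.step_nonneg i
  rw [ratio', gap_eq]
  by_cases h : X.step (i - 1) + X.step i = 0
  · rw [h]
    have : X.step (i - 1) = 0 := by linarith
    simp [this]
  · field_simp

lemma step_add_step_pos {i : ℤ} (h1 : 1 ≤ i) (h2 : i ≤ X.m + 1) :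
    0 < X.step (i - 1) + X.step i := by
  have hm := X.m_pos
  rcases h2.lt_or_eq with h | h
  · exact add_pos_of_nonneg_of_pos (X.step_nonneg _) (X.step_pos h1 (by omega))
  · exact add_pos_of_pos_of_nonneg (X.step_pos (by omega) (by omega)) (X.step_nonneg _)

lemma ratio_add_ratio' {i : ℤ} (h1 : 1 ≤ i) (h2 : i ≤ X.m + 1) :
    X.ratio i + X.ratio' i = 1 := by
  have := X.step_add_step_pos h1 h2
  rw [ratio, ratio', ← add_div, add_comm (X.step i), div_self this.ne']

lemma ratio_nonneg (i : ℤ) : 0 ≤ X.ratio i :=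
  div_nonneg (X.step_nonneg _) (add_nonneg (X.step_nonneg _) (X.step_nonneg _))

lemma ratio'_nonneg (i : ℤ) : 0 ≤ X.ratio' i :=
  div_nonneg (X.step_nonneg _) (add_nonneg (X.step_nonneg _) (X.step_nonneg _))

lemma ratio_le_one (i : ℤ) : X.ratio i ≤ 1 :=
  div_le_one_of_le₀ (le_add_of_nonneg_left (X.step_nonneg _))
    (add_nonneg (X.step_nonneg _) (X.step_nonneg _))

lemma ratio'_le_one (i : ℤ) : X.ratio' i ≤ 1 :=
  div_le_one_of_le₀ (le_add_of_nonneg_right (X.step_nonneg _))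
    (add_nonneg (X.step_nonneg _) (X.step_nonneg _))

/-- Since σ_i (s_i - s_{i-1}) and σ'_{i+1} (s_{i+1} - s_i) both equal h_i / 2, each side is -σ_i
σ'_{i+1} / (σ_i + σ'_{i+1}) times h_i / 2. This is the exactness of μ_ij on functions linear in x,
and it also lets an error over a neighbouring gap be measured by the gap at hand. -/
lemma coefA_mul_gap (i : ℤ) : X.coefA i * X.gap i = X.coefC i * X.gap (i + 1) := by
  unfold coefA coefC
  split_ifs with h
  · have h1 := X.ratio_mul_gap i
    have h2 := X.ratio'_mul_gap (i + 1)
    rw [add_sub_cancel_right] at h2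
    rw [div_mul_eq_mul_div, div_mul_eq_mul_div]
    congr 1
    linear_combination
      -(X.ratio i * X.ratio' (i + 1)) * h1 + (X.ratio i * X.ratio' (i + 1)) * h2
  · simp

lemma abs_coefA_le_one (i : ℤ) : |X.coefA i| ≤ 1 := by
  unfold coefA
  have h1 := X.ratio_nonneg i
  have h2 := X.ratio'_nonneg (i + 1)
  have h3 := X.ratio_le_one i
  have h4 := X.ratio'_le_one (i + 1)
  split_ifs with h
  · rw [abs_div, abs_neg, abs_of_nonneg (by positivity), abs_of_nonneg (by positivity)]
    refine div_le_one_of_le₀ ?_ (by positivity)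
    have : X.ratio i ^ 2 ≤ 1 := pow_le_one₀ h1 h3
    nlinarith
  · simp

lemma abs_coefC_le_one (i : ℤ) : |X.coefC i| ≤ 1 := by
  unfold coefC
  have h1 := X.ratio_nonneg i
  have h2 := X.ratio'_nonneg (i + 1)
  have h3 := X.ratio_le_one i
  have h4 := X.ratio'_le_one (i + 1)
  split_ifs with h
  · rw [abs_div, abs_neg, abs_of_nonneg (by positivity), abs_of_nonneg (by positivity)]
    refine div_le_one_of_le₀ ?_ (by positivity)
    have : X.ratio' (i + 1) ^ 2 ≤ 1 := pow_le_one₀ h2 h4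
    nlinarith
  · simp

/-! ### Subintervals and local coordinates -/

/-- The subinterval `[x_{r-1}, x_r]`. -/
def subinterval (r : ℤ) : Set ℝ := Set.Icc (X.knot (r - 1)) (X.knot r)

lemma subinterval_subset_segment (r : ℤ) : X.subinterval r ⊆ X.segment :=
  Set.Icc_subset_Icc (X.knot_mem_segment _).1 (X.knot_mem_segment _).2

/-- The knots strictly to the left of t form an initial segment, so their number is the index of the
first knot that is at least t. The maximum with 1 only intervenes at t = x_0, where that number is
0. -/
lemma cell_mem {t : ℝ} (ht : t ∈ X.segment) :
    X.cell t ∈ Finset.Icc (1 : ℤ) X.m ∧ t ∈ X.subinterval (X.cell t) := by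
  have hm := X.m_pos
  set S : Finset (Fin (X.m + 1)) := {k : Fin (X.m + 1) | X.pt k < t} with hS
  have hcell : X.cell t = max 1 (S.card : ℤ) := rfl
  have hlast : t ≤ X.pt ⟨X.m, by omega⟩ := by
    have := ht.2
    rwa [X.knot_natCast le_rfl] at this
  have hle : S.card ≤ X.m := by
    have : S ⊆ Finset.Iio (⟨X.m, by omega⟩ : Fin (X.m + 1)) := fun k hk => by
      rw [hS, Finset.mem_filter] at hk
      exact Finset.mem_Iio.2 (X.strictMono_pt.lt_iff_lt.1 (hk.2.trans_le hlast))
    simpa using Finset.card_le_card this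
  have hup : t ≤ X.knot S.card := by
    rw [X.knot_natCast hle]
    by_contra! h
    have : Finset.Iic (⟨S.card, by omega⟩ : Fin (X.m + 1)) ⊆ S := fun k hk => by
      rw [hS, Finset.mem_filter]
      exact ⟨Finset.mem_univ _, (X.strictMono_pt.monotone (Finset.mem_Iic.1 hk)).trans_lt h⟩
    have := Finset.card_le_card this
    simp at this
  have hlow (h : 1 ≤ S.card) : X.knot (S.card - 1) ≤ t := by
    rw [show ((S.card : ℤ) - 1) = ((S.card - 1 : ℕ) : ℤ) by omega,
      X.knot_natCast (by omega)]
    by_contra! h'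
    have : S ⊆ Finset.Iio (⟨S.card - 1, by omega⟩ : Fin (X.m + 1)) := fun k hk => by
      rw [hS, Finset.mem_filter] at hk
      exact Finset.mem_Iio.2 (X.strictMono_pt.lt_iff_lt.1 (hk.2.trans h'))
    have := Finset.card_le_card this
    simp at this
    omega
  rcases Nat.eq_zero_or_pos S.card with h | h
  · have h1 : X.cell t = 1 := by rw [hcell, h]; simp
    rw [h1]
    refine ⟨Finset.mem_Icc.2 ⟨le_rfl, by omega⟩, by simpa using ht.1, ?_⟩
    rw [h] at hup
    exact hup.trans (X.knot_mono (by simp))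
  · have h1 : X.cell t = S.card := by rw [hcell, max_eq_right (by omega)]
    rw [h1]
    exact ⟨Finset.mem_Icc.2 ⟨by omega, by omega⟩, hlow h, hup⟩

/-- Two subintervals with a common point are equal or adjacent, the point being the common knot. -/
lemma eq_or_of_mem_subinterval {r r' : ℤ} (hr : r ∈ Finset.Icc (1 : ℤ) X.m)
    (hr' : r' ∈ Finset.Icc (1 : ℤ) X.m) (h : r < r') {t : ℝ} (ht : t ∈ X.subinterval r)
    (ht' : t ∈ X.subinterval r') : r' = r + 1 ∧ t = X.knot r := by
  rw [Finset.mem_Icc] at hr hr'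
  have h1 : X.knot (r' - 1) ≤ X.knot r := ht'.1.trans ht.2
  have h2 : r' = r + 1 := by
    by_contra hne
    have h3 := X.knot_sub_one_lt (i := r + 1) (by omega) (by omega)
    have h4 := X.knot_mono (show r + 1 ≤ r' - 1 by omega)
    rw [add_sub_cancel_right] at h3
    linarith
  subst h2
  refine ⟨rfl, le_antisymm ht.2 ?_⟩
  have := ht'.1
  rwa [add_sub_cancel_right] at this

lemma localCoord_mem {r : ℤ} (hr : r ∈ Finset.Icc (1 : ℤ) X.m) {t : ℝ}
    (ht : t ∈ X.subinterval r) : X.localCoord r t ∈ Set.Icc (-1 : ℝ) 1 := by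
  rw [Finset.mem_Icc] at hr
  have h := X.step_pos hr.1 hr.2
  unfold localCoord mid
  obtain ⟨h1, h2⟩ := ht
  constructor
  · rw [le_div_iff₀ (by positivity), step]
    linarith
  · rw [div_le_iff₀ (by positivity), step]
    linarith

lemma localCoord_knot {r : ℤ} (hr : r ∈ Finset.Icc (1 : ℤ) X.m) :
    X.localCoord r (X.knot r) = 1 := by
  rw [Finset.mem_Icc] at hr
  have h := X.step_pos hr.1 hr.2
  rw [localCoord, div_eq_one_iff_eq (by positivity), mid, step]
  ring

lemma localCoord_knot_sub_one {r : ℤ} (hr : r ∈ Finset.Icc (1 : ℤ) X.m) :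
    X.localCoord r (X.knot (r - 1)) = -1 := by
  rw [Finset.mem_Icc] at hr
  have h := X.step_pos hr.1 hr.2
  rw [localCoord, div_eq_iff (by positivity), mid, step]
  ring

end Knots

/-! ### The quadratic form on the reference square -/

/-- The square of the positive part. -/
def sqPos (t : ℝ) : ℝ := max t 0 ^ 2

lemma hasDerivAt_sqPos (t : ℝ) : HasDerivAt sqPos (2 * max t 0) t := by
  have hr : ∀ t : ℝ, 0 ≤ t → HasDerivWithinAt sqPos (2 * max t 0) (Set.Ici 0) t := fun t ht => by
    have h : HasDerivWithinAt (fun x : ℝ => x ^ 2) (2 * t) (Set.Ici 0) t := by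
      simpa using (hasDerivAt_pow 2 t).hasDerivWithinAt
    rw [max_eq_left ht]
    refine h.congr (fun x hx => ?_) ?_
    · rw [sqPos, max_eq_left hx]
    · rw [sqPos, max_eq_left ht]
  have hl : ∀ t : ℝ, t ≤ 0 → HasDerivWithinAt sqPos (2 * max t 0) (Set.Iic 0) t := fun t ht => by
    rw [max_eq_right ht, mul_zero]
    refine (hasDerivWithinAt_const t (Set.Iic 0) (0 : ℝ)).congr (fun x hx => ?_) ?_
    · rw [sqPos, max_eq_right hx]
      simp
    · rw [sqPos, max_eq_right ht]
      simp
  rcases lt_trichotomy t 0 with h | h | h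
  · exact (hl t h.le).hasDerivAt (Iic_mem_nhds h)
  · subst h
    have := (hl 0 le_rfl).union (hr 0 le_rfl)
    rwa [Set.Iic_union_Ici, hasDerivWithinAt_univ] at this
  · exact (hr t h.le).hasDerivAt (Ici_mem_nhds h)

/-- The `C¹` quadratic form on the criss-cross triangulation of the square with values `c` at the
corners, in terms of truncated powers; `dv`, `dh` are the coefficients at the midpoints of the
sides. -/
def squareForm (c : Bool → Bool → ℝ) (dv dh : Bool → ℝ) (u v : ℝ) : ℝ :=
  ((c true true - dv true - dh true) * sqPos (u + v)
    + (c true false - dv true - dh false) * sqPos (u - v)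
    + (c false true - dv false - dh true) * sqPos (-u + v)
    + (c false false - dv false - dh false) * sqPos (-u - v)
    + dv true * (1 + u) ^ 2 + dv false * (1 - u) ^ 2
    + dh true * (1 + v) ^ 2 + dh false * (1 - v) ^ 2) / 4

/-- The partial derivative of `squareForm` with respect to `u`. -/
def squareFormU (c : Bool → Bool → ℝ) (dv dh : Bool → ℝ) (u v : ℝ) : ℝ :=
  ((c true true - dv true - dh true) * max (u + v) 0
    + (c true false - dv true - dh false) * max (u - v) 0
    - (c false true - dv false - dh true) * max (-u + v) 0
    - (c false false - dv false - dh false) * max (-u - v) 0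
    + dv true * (1 + u) - dv false * (1 - u)) / 2

/-- The partial derivative of `squareForm` with respect to `v`. -/
def squareFormV (c : Bool → Bool → ℝ) (dv dh : Bool → ℝ) (u v : ℝ) : ℝ :=
  ((c true true - dv true - dh true) * max (u + v) 0
    - (c true false - dv true - dh false) * max (u - v) 0
    + (c false true - dv false - dh true) * max (-u + v) 0
    - (c false false - dv false - dh false) * max (-u - v) 0
    + dh true * (1 + v) - dh false * (1 - v)) / 2

/-- Averaged coefficients on the half-diagonals and at the centre are what C¹ continuity across the
diagonals demands, so the four quadratic pieces differ only by squares of u + v and u - v. The signs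
of these two forms select the triangle, on which max(|u|, |v|) is linear and the identity is
polynomial. -/
lemma bbForm_eq_squareForm (c : Bool → Bool → ℝ) (dv dh : Bool → ℝ) (u v : ℝ) :
    bbForm c dv dh (fun b b' => (dv b + dh b') / 2)
      ((dv true + dv false + dh true + dh false) / 4) u v = squareForm c dv dh u v := by
  simp only [bbForm, squareForm, sqPos, Fintype.sum_bool, if_true, Bool.false_eq_true, if_false]
  rcases le_total 0 (u + v) with h1 | h1 <;> rcases le_total 0 (u - v) with h2 | h2
  · rw [show max |u| |v| = u by
      rw [abs_of_nonneg (by linarith), max_eq_left (abs_le.2 ⟨by linarith, by linarith⟩)]]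
    simp only [one_mul, neg_one_mul, ← sub_eq_add_neg]
    rw [max_eq_left h1, max_eq_left h2, max_eq_right (by linarith), max_eq_right (by linarith)]
    ring
  · rw [show max |u| |v| = v by
      rw [abs_of_nonneg (a := v) (by linarith),
        max_eq_right (abs_le.2 ⟨by linarith, by linarith⟩)]]
    simp only [one_mul, neg_one_mul, ← sub_eq_add_neg]
    rw [max_eq_left h1, max_eq_right h2, max_eq_left (a := -u + v) (by linarith),
      max_eq_right (by linarith)]
    ring
  · rw [show max |u| |v| = -v by
      rw [abs_of_nonpos (a := v) (by linarith),
        max_eq_right (abs_le.2 ⟨by linarith, by linarith⟩)]]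
    simp only [one_mul, neg_one_mul, ← sub_eq_add_neg]
    rw [max_eq_right h1, max_eq_left h2, max_eq_right (a := -u + v) (by linarith),
      max_eq_left (by linarith)]
    ring
  · rw [show max |u| |v| = -u by
      rw [abs_of_nonpos (by linarith), max_eq_left (abs_le.2 ⟨by linarith, by linarith⟩)]]
    simp only [one_mul, neg_one_mul, ← sub_eq_add_neg]
    rw [max_eq_right h1, max_eq_right h2, max_eq_left (by linarith), max_eq_left (by linarith)]
    ring

lemma squareForm_swap (c : Bool → Bool → ℝ) (dv dh : Bool → ℝ) (u v : ℝ) :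
    squareForm (fun b b' => c b' b) dh dv v u = squareForm c dv dh u v := by
  simp only [squareForm]
  rw [add_comm v u, show v - u = -u + v by ring, show -v + u = u - v by ring,
    show -v - u = -u - v by ring]
  ring

lemma hasFDerivAt_squareForm (c : Bool → Bool → ℝ) (dv dh : Bool → ℝ) (q : ℝ × ℝ) :
    HasFDerivAt (fun q : ℝ × ℝ => squareForm c dv dh q.1 q.2)
      (squareFormU c dv dh q.1 q.2 • ContinuousLinearMap.fst ℝ ℝ ℝ
        + squareFormV c dv dh q.1 q.2 • ContinuousLinearMap.snd ℝ ℝ ℝ) q := by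
  have hu : HasFDerivAt (fun q : ℝ × ℝ => q.1) (ContinuousLinearMap.fst ℝ ℝ ℝ) q := hasFDerivAt_fst
  have hv : HasFDerivAt (fun q : ℝ × ℝ => q.2) (ContinuousLinearMap.snd ℝ ℝ ℝ) q := hasFDerivAt_snd
  have h1 := (hasDerivAt_sqPos (q.1 + q.2)).comp_hasFDerivAt q (hu.add hv)
  have h2 := (hasDerivAt_sqPos (q.1 - q.2)).comp_hasFDerivAt q (hu.sub hv)
  have h3 := (hasDerivAt_sqPos (-q.1 + q.2)).comp_hasFDerivAt q (hu.neg.add hv)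
  have h4 := (hasDerivAt_sqPos (-q.1 - q.2)).comp_hasFDerivAt q (hu.neg.sub hv)
  have h := ((((((((h1.const_mul (c true true - dv true - dh true)).add
    (h2.const_mul (c true false - dv true - dh false))).add
    (h3.const_mul (c false true - dv false - dh true))).add
    (h4.const_mul (c false false - dv false - dh false))).add
    (((hu.const_add 1).pow 2).const_mul (dv true))).add
    (((hu.const_sub 1).pow 2).const_mul (dv false))).add
    (((hv.const_add 1).pow 2).const_mul (dh true))).add
    (((hv.const_sub 1).pow 2).const_mul (dh false))).const_mul (1 / 4)
  refine (h.congr_fderiv ?_).congr_of_eventuallyEq (Filter.Eventually.of_forall fun x => ?_)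
  · ext <;> simp [squareFormU, squareFormV] <;> ring
  · simp [squareForm]
    ring

lemma continuous_squareFormU (c : Bool → Bool → ℝ) (dv dh : Bool → ℝ) :
    Continuous fun q : ℝ × ℝ => squareFormU c dv dh q.1 q.2 := by
  unfold squareFormU
  fun_prop

lemma continuous_squareFormV (c : Bool → Bool → ℝ) (dv dh : Bool → ℝ) :
    Continuous fun q : ℝ × ℝ => squareFormV c dv dh q.1 q.2 := by
  unfold squareFormV
  fun_prop

/-- On the square, the `u`-derivative is a convex combination of its values at the centre and at
the corners. -/
lemma abs_squareFormU_sub_le {c : Bool → Bool → ℝ} {dv dh : Bool → ℝ} {F E u v : ℝ}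
    (hu : u ∈ Set.Icc (-1 : ℝ) 1) (hv : v ∈ Set.Icc (-1 : ℝ) 1)
    (h0 : |(dv true - dv false) / 2 - F| ≤ E)
    (hp : ∀ b, |c true b - dh b - F| ≤ E) (hn : ∀ b, |dh b - c false b - F| ≤ E) :
    |squareFormU c dv dh u v - F| ≤ E := by
  have hp1 := abs_le.1 (hp true)
  have hp2 := abs_le.1 (hp false)
  have hn1 := abs_le.1 (hn true)
  have hn2 := abs_le.1 (hn false)
  have h0' := abs_le.1 h0
  -- The weights will be the barycentric coordinates of (u, v): `w0` for the centre, the others for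
  -- the corners. The factors are the values of the u-derivative there.
  have key : ∀ w0 a b d e : ℝ, 0 ≤ w0 → 0 ≤ a → 0 ≤ b → 0 ≤ d → 0 ≤ e → w0 + a + b + d + e = 1 →
      |w0 * ((dv true - dv false) / 2) + a * (c true true - dh true)
        + b * (c true false - dh false) + d * (dh true - c false true)
        + e * (dh false - c false false) - F| ≤ E := by
    intro w0 a b d e h h1 h2 h3 h4 hs
    rw [show w0 = 1 - a - b - d - e by linarith] at h ⊢
    rw [abs_le]
    constructor
    · nlinarith [mul_le_mul_of_nonneg_left h0'.1 h, mul_le_mul_of_nonneg_left hp1.1 h1,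
        mul_le_mul_of_nonneg_left hp2.1 h2, mul_le_mul_of_nonneg_left hn1.1 h3,
        mul_le_mul_of_nonneg_left hn2.1 h4]
    · nlinarith [mul_le_mul_of_nonneg_left h0'.2 h, mul_le_mul_of_nonneg_left hp1.2 h1,
        mul_le_mul_of_nonneg_left hp2.2 h2, mul_le_mul_of_nonneg_left hn1.2 h3,
        mul_le_mul_of_nonneg_left hn2.2 h4]
  have e1 : max (u + v) 0 - max (-u - v) 0 = u + v := by
    rw [show -u - v = -(u + v) by ring]
    rcases le_total 0 (u + v) with h | h
    · rw [max_eq_left h, max_eq_right (by linarith)]; ring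
    · rw [max_eq_right h, max_eq_left (by linarith)]; ring
  have e2 : max (u - v) 0 - max (-u + v) 0 = u - v := by
    rw [show -u + v = -(u - v) by ring]
    rcases le_total 0 (u - v) with h | h
    · rw [max_eq_left h, max_eq_right (by linarith)]; ring
    · rw [max_eq_right h, max_eq_left (by linarith)]; ring
  -- The sum is 2 max(|u|, |v|), so the weight of the centre is nonnegative on the square.
  have e3 : max (u + v) 0 + max (u - v) 0 + max (-u + v) 0 + max (-u - v) 0 ≤ 2 := by
    obtain ⟨h1, h2⟩ := hu
    obtain ⟨h3, h4⟩ := hv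
    rcases le_total 0 (u + v) with h | h <;> rcases le_total 0 (u - v) with h' | h'
    · rw [max_eq_left h, max_eq_left h', max_eq_right (by linarith), max_eq_right (by linarith)]
      linarith
    · rw [max_eq_left h, max_eq_right h', max_eq_left (by linarith), max_eq_right (by linarith)]
      linarith
    · rw [max_eq_right h, max_eq_left h', max_eq_right (by linarith), max_eq_left (by linarith)]
      linarith
    · rw [max_eq_right h, max_eq_right h', max_eq_left (by linarith), max_eq_left (by linarith)]
      linarith
  have k1 := le_max_right (u + v) 0
  have k2 := le_max_right (u - v) 0
  have k3 := le_max_right (-u + v) 0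
  have k4 := le_max_right (-u - v) 0
  unfold squareFormU
  generalize max (u + v) 0 = a at *
  generalize max (u - v) 0 = b at *
  generalize max (-u + v) 0 = d at *
  generalize max (-u - v) 0 = e at *
  have := key (1 - (a + b + d + e) / 2) (a / 2) (b / 2) (d / 2) (e / 2) (by linarith)
    (by linarith) (by linarith) (by linarith) (by linarith) (by ring)
  convert this using 2
  have hu' : u = (a + b - d - e) / 2 := by linarith
  rw [hu']
  ring

lemma max_one_add {v : ℝ} (hv : v ∈ Set.Icc (-1 : ℝ) 1) :
    max (1 + v) 0 = 1 + v ∧ max (1 - v) 0 = 1 - v ∧ max (-1 + v) 0 = 0 ∧ max (-1 - v) 0 = 0 :=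
  ⟨max_eq_left (by linarith [hv.1]), max_eq_left (by linarith [hv.2]),
    max_eq_right (by linarith [hv.2]), max_eq_right (by linarith [hv.1])⟩

/-- The values of the form and of its derivatives on the right side of the square. -/
lemma squareForm_one (c : Bool → Bool → ℝ) (dv dh : Bool → ℝ) {v : ℝ}
    (hv : v ∈ Set.Icc (-1 : ℝ) 1) :
    squareForm c dv dh 1 v = (c true true * (1 + v) ^ 2 + 2 * dv true * (1 - v ^ 2)
        + c true false * (1 - v) ^ 2) / 4 ∧
      squareFormU c dv dh 1 v = ((c true true - dh true) * (1 + v)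
        + (c true false - dh false) * (1 - v)) / 2 ∧
      squareFormV c dv dh 1 v = ((c true true - dv true) * (1 + v)
        - (c true false - dv true) * (1 - v)) / 2 := by
  obtain ⟨h1, h2, h3, h4⟩ := max_one_add hv
  refine ⟨?_, ?_, ?_⟩ <;>
    simp only [squareForm, squareFormU, squareFormV, sqPos, h1, h2, h3, h4] <;> ring

/-- The values of the form and of its derivatives on the left side of the square. -/
lemma squareForm_neg_one (c : Bool → Bool → ℝ) (dv dh : Bool → ℝ) {v : ℝ}
    (hv : v ∈ Set.Icc (-1 : ℝ) 1) :
    squareForm c dv dh (-1) v = (c false true * (1 + v) ^ 2 + 2 * dv false * (1 - v ^ 2)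
        + c false false * (1 - v) ^ 2) / 4 ∧
      squareFormU c dv dh (-1) v = ((dh true - c false true) * (1 + v)
        + (dh false - c false false) * (1 - v)) / 2 ∧
      squareFormV c dv dh (-1) v = ((c false true - dv false) * (1 + v)
        - (c false false - dv false) * (1 - v)) / 2 := by
  obtain ⟨h1, h2, h3, h4⟩ := max_one_add hv
  refine ⟨?_, ?_, ?_⟩ <;>
    simp only [squareForm, squareFormU, squareFormV, sqPos, neg_neg, h1, h2, h3, h4] <;> ring

lemma squareFormU_swap (c : Bool → Bool → ℝ) (dv dh : Bool → ℝ) (u v : ℝ) :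
    squareFormU (fun b b' => c b' b) dh dv v u = squareFormV c dv dh u v := by
  simp only [squareFormU, squareFormV]
  rw [add_comm v u, show v - u = -u + v by ring, show -v + u = u - v by ring,
    show -v - u = -u - v by ring]
  ring

/-! ### Splines with given B-spline coefficients -/

/-- The index of the right (`true`) or left (`false`) end of the `r`-th subinterval. -/
def sideIndex (r : ℤ) (b : Bool) : ℤ := if b then r else r - 1

lemma sideIndex_true (r : ℤ) : sideIndex r true = r := rfl

lemma sideIndex_false (r : ℤ) : sideIndex r false = r - 1 := rfl

lemma sideIndex_mem {m r : ℤ} (hr : r ∈ Finset.Icc 1 m) (b : Bool) :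
    0 ≤ sideIndex r b ∧ sideIndex r b ≤ m := by
  rw [Finset.mem_Icc] at hr
  cases b
  · rw [sideIndex_false]; omega
  · rw [sideIndex_true]; omega

namespace Knots

variable (X : Knots)

/-- The value at the knot `x_k` of the univariate quadratic spline with coefficients `φ`. -/
def blend (φ : ℤ → ℝ) (k : ℤ) : ℝ := X.ratio (k + 1) * φ k + X.ratio' (k + 1) * φ (k + 1)

variable {X} in
lemma blend_sub {k : ℤ} (h0 : 0 ≤ k) (hm : k ≤ X.m) (φ : ℤ → ℝ) :
    X.blend φ k - φ k = X.ratio' (k + 1) * (φ (k + 1) - φ k) := by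
  have := X.ratio_add_ratio' (i := k + 1) (by omega) (by omega)
  rw [blend]
  linear_combination φ k * this

variable {X} in
lemma sub_blend {k : ℤ} (h0 : 0 ≤ k) (hm : k ≤ X.m) (φ : ℤ → ℝ) :
    φ (k + 1) - X.blend φ k = X.ratio (k + 1) * (φ (k + 1) - φ k) := by
  have := X.ratio_add_ratio' (i := k + 1) (by omega) (by omega)
  rw [blend]
  linear_combination -φ (k + 1) * this

lemma sum_mul_knotValue {k : ℤ} (h0 : 0 ≤ k) (hm : k ≤ X.m) (φ : ℤ → ℝ) :
    ∑ i ∈ Finset.Icc (0 : ℤ) (X.m + 1), φ i * X.knotValue k i = X.blend φ k := by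
  have h : ∀ i, φ i * X.knotValue k i = (if i = k then φ i * X.ratio (k + 1) else 0)
      + (if i = k + 1 then φ i * X.ratio' (k + 1) else 0) := by
    intro i
    unfold knotValue
    split_ifs with h1 h2 <;> first | omega | simp
  simp only [h, Finset.sum_add_distrib, Finset.sum_ite_eq']
  rw [if_pos (Finset.mem_Icc.2 ⟨h0, by omega⟩), if_pos (Finset.mem_Icc.2 ⟨by omega, by omega⟩),
    blend]
  ring

end Knots

/-- The spline with B-spline coefficients `φ`. -/
def spline (X Y : Knots) (φ : ℤ → ℤ → ℝ) (p : ℝ × ℝ) : ℝ :=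
  ∑ i ∈ Finset.Icc (0 : ℤ) (X.m + 1), ∑ j ∈ Finset.Icc (0 : ℤ) (Y.m + 1),
    φ i j * bspline X Y i j p

/-- The values of a spline at the corners of a subrectangle. -/
def cornerCoef (X Y : Knots) (φ : ℤ → ℤ → ℝ) (r s : ℤ) (b b' : Bool) : ℝ :=
  X.blend (fun i => Y.blend (φ i) (sideIndex s b')) (sideIndex r b)

/-- The coefficients of a spline on the vertical sides of a subrectangle. -/
def vertCoef (X : Knots) (φ : ℤ → ℤ → ℝ) (r s : ℤ) (b : Bool) : ℝ :=
  X.blend (fun i => φ i s) (sideIndex r b)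

/-- The coefficients of a spline on the horizontal sides of a subrectangle. -/
def horCoef (Y : Knots) (φ : ℤ → ℤ → ℝ) (r s : ℤ) (b : Bool) : ℝ :=
  Y.blend (φ r) (sideIndex s b)

/-- The quadratic form of a spline on a subrectangle. -/
def cellForm (X Y : Knots) (φ : ℤ → ℤ → ℝ) (r s : ℤ) (p : ℝ × ℝ) : ℝ :=
  squareForm (cornerCoef X Y φ r s) (vertCoef X φ r s) (horCoef Y φ r s)
    (X.localCoord r p.1) (Y.localCoord s p.2)

/-- The first partial derivative of a spline on a subrectangle. -/
def cellGradX (X Y : Knots) (φ : ℤ → ℤ → ℝ) (r s : ℤ) (p : ℝ × ℝ) : ℝ :=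
  squareFormU (cornerCoef X Y φ r s) (vertCoef X φ r s) (horCoef Y φ r s)
    (X.localCoord r p.1) (Y.localCoord s p.2) * (2 / X.step r)

/-- The second partial derivative of a spline on a subrectangle. -/
def cellGradY (X Y : Knots) (φ : ℤ → ℤ → ℝ) (r s : ℤ) (p : ℝ × ℝ) : ℝ :=
  squareFormV (cornerCoef X Y φ r s) (vertCoef X φ r s) (horCoef Y φ r s)
    (X.localCoord r p.1) (Y.localCoord s p.2) * (2 / Y.step s)

/-- Linearity of the form in its coefficients, with the point fixed; this allows a sum of B-splines
to be taken coefficient by coefficient. -/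
lemma exists_squareForm_eq_sum (u v : ℝ) : ∃ (a : Bool → Bool → ℝ) (β γ : Bool → ℝ),
    ∀ (c : Bool → Bool → ℝ) (dv dh : Bool → ℝ), squareForm c dv dh u v =
      ∑ b, ∑ b', c b b' * a b b' + ∑ b, dv b * β b + ∑ b, dh b * γ b := by
  let pt : Bool → Bool → ℝ := fun b b' =>
    sqPos ((if b then u else -u) + (if b' then v else -v)) / 4
  refine ⟨pt, fun b => (1 + if b then u else -u) ^ 2 / 4 - ∑ b', pt b b',
    fun b' => (1 + if b' then v else -v) ^ 2 / 4 - ∑ b, pt b b', fun c dv dh => ?_⟩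
  simp only [pt, squareForm, Fintype.sum_bool, if_true, Bool.false_eq_true, if_false,
    ← sub_eq_add_neg]
  ring

lemma bsplineCell_eq_squareForm (X Y : Knots) (i j r s : ℤ) (p : ℝ × ℝ) :
    bsplineCell X Y i j r s p = squareForm
      (fun b b' => X.knotValue (sideIndex r b) i * Y.knotValue (sideIndex s b') j)
      (fun b => X.knotValue (sideIndex r b) i * (if j = s then 1 else 0))
      (fun b => (if i = r then 1 else 0) * Y.knotValue (sideIndex s b) j)
      (X.localCoord r p.1) (Y.localCoord s p.2) := by
  rw [← bbForm_eq_squareForm]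
  rfl

lemma sum_bsplineCell (X Y : Knots) (φ : ℤ → ℤ → ℝ) {r s : ℤ}
    (hr : r ∈ Finset.Icc (1 : ℤ) X.m) (hs : s ∈ Finset.Icc (1 : ℤ) Y.m) (p : ℝ × ℝ) :
    ∑ i ∈ Finset.Icc (0 : ℤ) (X.m + 1), ∑ j ∈ Finset.Icc (0 : ℤ) (Y.m + 1),
      φ i j * bsplineCell X Y i j r s p = cellForm X Y φ r s p := by
  obtain ⟨a, β, γ, h⟩ := exists_squareForm_eq_sum (X.localCoord r p.1) (Y.localCoord s p.2)
  simp only [bsplineCell_eq_squareForm, cellForm, h]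
  have hr' := Finset.mem_Icc.1 hr
  have hs' := Finset.mem_Icc.1 hs
  have hc : ∀ b b', ∑ i ∈ Finset.Icc (0 : ℤ) (X.m + 1), ∑ j ∈ Finset.Icc (0 : ℤ) (Y.m + 1),
      φ i j * (X.knotValue (sideIndex r b) i * Y.knotValue (sideIndex s b') j)
        = cornerCoef X Y φ r s b b' := fun b b' => by
    rw [cornerCoef, ← X.sum_mul_knotValue (sideIndex_mem hr b).1 (sideIndex_mem hr b).2]
    refine Finset.sum_congr rfl fun i _ => ?_
    rw [← Y.sum_mul_knotValue (sideIndex_mem hs b').1 (sideIndex_mem hs b').2, Finset.sum_mul]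
    exact Finset.sum_congr rfl fun j _ => by ring
  have hv : ∀ b, ∑ i ∈ Finset.Icc (0 : ℤ) (X.m + 1), ∑ j ∈ Finset.Icc (0 : ℤ) (Y.m + 1),
      φ i j * (X.knotValue (sideIndex r b) i * (if j = s then 1 else 0))
        = vertCoef X φ r s b := fun b => by
    rw [vertCoef, ← X.sum_mul_knotValue (sideIndex_mem hr b).1 (sideIndex_mem hr b).2]
    refine Finset.sum_congr rfl fun i _ => ?_
    simp only [mul_ite, mul_one, mul_zero, Finset.sum_ite_eq']
    rw [if_pos (Finset.mem_Icc.2 ⟨by omega, by omega⟩)]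
  have hh : ∀ b, ∑ i ∈ Finset.Icc (0 : ℤ) (X.m + 1), ∑ j ∈ Finset.Icc (0 : ℤ) (Y.m + 1),
      φ i j * ((if i = r then 1 else 0) * Y.knotValue (sideIndex s b) j)
        = horCoef Y φ r s b := fun b => by
    rw [horCoef, ← Y.sum_mul_knotValue (sideIndex_mem hs b).1 (sideIndex_mem hs b).2]
    rw [Finset.sum_eq_single_of_mem r (Finset.mem_Icc.2 ⟨by omega, by omega⟩)]
    · simp
    · intro i _ hi
      simp [hi]
  simp only [← hc, ← hv, ← hh, Fintype.sum_bool, Finset.sum_mul, ← Finset.sum_add_distrib]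
  exact Finset.sum_congr rfl fun i _ => Finset.sum_congr rfl fun j _ => by ring

lemma cornerCoef_swap (X Y : Knots) (φ : ℤ → ℤ → ℝ) (r s : ℤ) :
    cornerCoef Y X (fun j i => φ i j) s r = fun b b' => cornerCoef X Y φ r s b' b := by
  ext b b'
  simp only [cornerCoef, Knots.blend]
  ring

lemma cellForm_swap (X Y : Knots) (φ : ℤ → ℤ → ℝ) (r s : ℤ) (p : ℝ × ℝ) :
    cellForm Y X (fun j i => φ i j) s r p.swap = cellForm X Y φ r s p := by
  rw [cellForm, cellForm, cornerCoef_swap]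
  exact squareForm_swap _ _ _ _ _

lemma cellGradX_swap (X Y : Knots) (φ : ℤ → ℤ → ℝ) (r s : ℤ) (p : ℝ × ℝ) :
    cellGradX Y X (fun j i => φ i j) s r p.swap = cellGradY X Y φ r s p := by
  rw [cellGradX, cellGradY, cornerCoef_swap, ← squareFormU_swap]
  rfl

lemma cellGradY_swap (X Y : Knots) (φ : ℤ → ℤ → ℝ) (r s : ℤ) (p : ℝ × ℝ) :
    cellGradY Y X (fun j i => φ i j) s r p.swap = cellGradX X Y φ r s p :=
  (cellGradX_swap Y X (fun j i => φ i j) s r p.swap).symm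

/-! ### Continuity across mesh lines and C¹ gluing -/

/-- A spline and its derivatives are continuous across the vertical mesh lines. -/
lemma cell_eq_succ (X Y : Knots) (φ : ℤ → ℤ → ℝ) {r s : ℤ}
    (hr : r ∈ Finset.Icc (1 : ℤ) X.m) (hr' : r + 1 ∈ Finset.Icc (1 : ℤ) X.m)
    (hs : s ∈ Finset.Icc (1 : ℤ) Y.m) {y : ℝ} (hy : y ∈ Y.subinterval s) :
    cellForm X Y φ r s (X.knot r, y) = cellForm X Y φ (r + 1) s (X.knot r, y) ∧
      cellGradX X Y φ r s (X.knot r, y) = cellGradX X Y φ (r + 1) s (X.knot r, y) ∧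
      cellGradY X Y φ r s (X.knot r, y) = cellGradY X Y φ (r + 1) s (X.knot r, y) := by
  have hv := Y.localCoord_mem hs hy
  have hl : X.localCoord (r + 1) (X.knot r) = -1 := by
    have := X.localCoord_knot_sub_one hr'
    rwa [add_sub_cancel_right] at this
  have hi : sideIndex (r + 1) false = sideIndex r true := by
    rw [sideIndex_false, sideIndex_true, add_sub_cancel_right]
  have hc : ∀ b, cornerCoef X Y φ (r + 1) s false b = cornerCoef X Y φ r s true b := fun b => by
    rw [cornerCoef, cornerCoef, hi]
  have hd : vertCoef X φ (r + 1) s false = vertCoef X φ r s true := by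
    rw [vertCoef, vertCoef, hi]
  simp only [cellForm, cellGradX, cellGradY, X.localCoord_knot hr, hl]
  obtain ⟨a1, a2, a3⟩ := squareForm_one (cornerCoef X Y φ r s) (vertCoef X φ r s)
    (horCoef Y φ r s) hv
  obtain ⟨b1, b2, b3⟩ := squareForm_neg_one (cornerCoef X Y φ (r + 1) s) (vertCoef X φ (r + 1) s)
    (horCoef Y φ (r + 1) s) hv
  rw [a1, a2, a3, b1, b2, b3, hc, hc, hd]
  refine ⟨rfl, ?_, rfl⟩
  rw [Finset.mem_Icc] at hr hr'
  -- Both sides equal the difference of the y-blends of columns r + 1 and r, divided by h_r +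
  -- h_{r+1}: the factors h_r and h_{r+1} in the numerators of `ratio'` and `ratio` cancel the
  -- denominators.
  have key : ∀ b, (cornerCoef X Y φ r s true b - horCoef Y φ r s b) / X.step r
      = (horCoef Y φ (r + 1) s b - cornerCoef X Y φ r s true b) / X.step (r + 1) := fun b => by
    have h1 := X.step_pos hr.1 hr.2
    have h2 := X.step_pos hr'.1 hr'.2
    have e1 := Knots.blend_sub (X := X) (k := r) (by omega) hr.2
      (fun i => Y.blend (φ i) (sideIndex s b))
    have e2 := Knots.sub_blend (X := X) (k := r) (by omega) hr.2
      (fun i => Y.blend (φ i) (sideIndex s b))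
    rw [cornerCoef, horCoef, horCoef, sideIndex_true, e1, e2, Knots.ratio, Knots.ratio',
      add_sub_cancel_right]
    field_simp
  linear_combination (1 + Y.localCoord s y) * key true + (1 - Y.localCoord s y) * key false

/-- A spline and its derivatives are given by each subrectangle that contains the point. -/
lemma cell_eq_left (X Y : Knots) (φ : ℤ → ℤ → ℝ) {r r' s : ℤ}
    (hr : r ∈ Finset.Icc (1 : ℤ) X.m) (hr' : r' ∈ Finset.Icc (1 : ℤ) X.m)
    (hs : s ∈ Finset.Icc (1 : ℤ) Y.m) {p : ℝ × ℝ} (hp : p.1 ∈ X.subinterval r)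
    (hp' : p.1 ∈ X.subinterval r') (hy : p.2 ∈ Y.subinterval s) :
    cellForm X Y φ r s p = cellForm X Y φ r' s p ∧
      cellGradX X Y φ r s p = cellGradX X Y φ r' s p ∧
      cellGradY X Y φ r s p = cellGradY X Y φ r' s p := by
  obtain ⟨x, y⟩ := p
  rcases lt_trichotomy r r' with h | rfl | h
  · obtain ⟨rfl, hx⟩ := X.eq_or_of_mem_subinterval hr hr' h hp hp'
    simp only at hx
    subst hx
    exact cell_eq_succ X Y φ hr hr' hs hy
  · exact ⟨rfl, rfl, rfl⟩
  · obtain ⟨rfl, hx⟩ := X.eq_or_of_mem_subinterval hr' hr h hp' hp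
    simp only at hx
    subst hx
    obtain ⟨h1, h2, h3⟩ := cell_eq_succ X Y φ hr' hr hs hy
    exact ⟨h1.symm, h2.symm, h3.symm⟩

lemma cell_eq (X Y : Knots) (φ : ℤ → ℤ → ℝ) {r r' s s' : ℤ}
    (hr : r ∈ Finset.Icc (1 : ℤ) X.m) (hr' : r' ∈ Finset.Icc (1 : ℤ) X.m)
    (hs : s ∈ Finset.Icc (1 : ℤ) Y.m) (hs' : s' ∈ Finset.Icc (1 : ℤ) Y.m) {p : ℝ × ℝ}
    (hp : p.1 ∈ X.subinterval r) (hp' : p.1 ∈ X.subinterval r')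
    (hy : p.2 ∈ Y.subinterval s) (hy' : p.2 ∈ Y.subinterval s') :
    cellForm X Y φ r s p = cellForm X Y φ r' s' p ∧
      cellGradX X Y φ r s p = cellGradX X Y φ r' s' p ∧
      cellGradY X Y φ r s p = cellGradY X Y φ r' s' p := by
  obtain ⟨a1, a2, a3⟩ := cell_eq_left X Y φ hr hr' hs hp hp' hy
  -- The change from s to s' is a change of column after the coordinates are exchanged.
  obtain ⟨b1, b2, b3⟩ := cell_eq_left Y X (fun j i => φ i j) (p := p.swap) hs hs' hr' hy hy' hp'
  rw [cellForm_swap, cellForm_swap] at b1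
  rw [cellGradX_swap, cellGradX_swap] at b2
  rw [cellGradY_swap, cellGradY_swap] at b3
  exact ⟨a1.trans b1, a2.trans b3, a3.trans b2⟩

/-- The first partial derivative of a spline. -/
def splineGradX (X Y : Knots) (φ : ℤ → ℤ → ℝ) (p : ℝ × ℝ) : ℝ :=
  cellGradX X Y φ (X.cell p.1) (Y.cell p.2) p

/-- The second partial derivative of a spline. -/
def splineGradY (X Y : Knots) (φ : ℤ → ℤ → ℝ) (p : ℝ × ℝ) : ℝ :=
  cellGradY X Y φ (X.cell p.1) (Y.cell p.2) p

/-- The derivative of a spline. -/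
def splineFDeriv (X Y : Knots) (φ : ℤ → ℤ → ℝ) (p : ℝ × ℝ) : ℝ × ℝ →L[ℝ] ℝ :=
  splineGradX X Y φ p • ContinuousLinearMap.fst ℝ ℝ ℝ
    + splineGradY X Y φ p • ContinuousLinearMap.snd ℝ ℝ ℝ

/-- The subrectangle `[x_{r-1}, x_r] × [y_{s-1}, y_s]`. -/
def subrectangle (X Y : Knots) (r s : ℤ) : Set (ℝ × ℝ) := X.subinterval r ×ˢ Y.subinterval s

/-- The B-splines are evaluated on the one subrectangle chosen by `cell`; agreement on common edges
frees the formula from that choice, so it holds on the whole closed subrectangle. -/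
lemma spline_eq_cellForm (X Y : Knots) (φ : ℤ → ℤ → ℝ) {r s : ℤ}
    (hr : r ∈ Finset.Icc (1 : ℤ) X.m) (hs : s ∈ Finset.Icc (1 : ℤ) Y.m) {p : ℝ × ℝ}
    (hp : p ∈ subrectangle X Y r s) :
    spline X Y φ p = cellForm X Y φ r s p ∧ splineGradX X Y φ p = cellGradX X Y φ r s p ∧
      splineGradY X Y φ p = cellGradY X Y φ r s p := by
  obtain ⟨h1, h2⟩ := X.cell_mem (X.subinterval_subset_segment r hp.1)
  obtain ⟨h3, h4⟩ := Y.cell_mem (Y.subinterval_subset_segment s hp.2)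
  have h := cell_eq X Y φ h1 hr h3 hs h2 hp.1 h4 hp.2
  refine ⟨?_, h.2⟩
  rw [← h.1, ← sum_bsplineCell X Y φ h1 h3]
  rfl

lemma hasFDerivAt_cellForm (X Y : Knots) (φ : ℤ → ℤ → ℝ) (r s : ℤ) (p : ℝ × ℝ) :
    HasFDerivAt (cellForm X Y φ r s)
      (cellGradX X Y φ r s p • ContinuousLinearMap.fst ℝ ℝ ℝ
        + cellGradY X Y φ r s p • ContinuousLinearMap.snd ℝ ℝ ℝ) p := by
  have hu : HasFDerivAt (fun p : ℝ × ℝ => X.localCoord r p.1)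
      ((2 / X.step r) • ContinuousLinearMap.fst ℝ ℝ ℝ) p := by
    have h := ((hasFDerivAt_fst (𝕜 := ℝ) (p := p)).sub_const (X.mid r)).const_mul (2 / X.step r)
    refine h.congr_of_eventuallyEq (Filter.Eventually.of_forall fun q => ?_)
    simp only [Knots.localCoord, div_div_eq_mul_div]
    ring
  have hv : HasFDerivAt (fun p : ℝ × ℝ => Y.localCoord s p.2)
      ((2 / Y.step s) • ContinuousLinearMap.snd ℝ ℝ ℝ) p := by
    have h := ((hasFDerivAt_snd (𝕜 := ℝ) (p := p)).sub_const (Y.mid s)).const_mul (2 / Y.step s)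
    refine h.congr_of_eventuallyEq (Filter.Eventually.of_forall fun q => ?_)
    simp only [Knots.localCoord, div_div_eq_mul_div]
    ring
  have h := (hasFDerivAt_squareForm (cornerCoef X Y φ r s) (vertCoef X φ r s) (horCoef Y φ r s)
    (X.localCoord r p.1, Y.localCoord s p.2)).comp p (hu.prodMk hv)
  refine (h.congr_fderiv ?_).congr_of_eventuallyEq (Filter.Eventually.of_forall fun x => rfl)
  ext <;> simp [cellGradX, cellGradY]

lemma continuous_cellGradX (X Y : Knots) (φ : ℤ → ℤ → ℝ) (r s : ℤ) :
    Continuous (cellGradX X Y φ r s) := by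
  have h : Continuous fun p : ℝ × ℝ => (X.localCoord r p.1, Y.localCoord s p.2) := by
    unfold Knots.localCoord
    fun_prop
  exact ((continuous_squareFormU _ _ _).comp h).mul continuous_const

lemma continuous_cellGradY (X Y : Knots) (φ : ℤ → ℤ → ℝ) (r s : ℤ) :
    Continuous (cellGradY X Y φ r s) := by
  have h : Continuous fun p : ℝ × ℝ => (X.localCoord r p.1, Y.localCoord s p.2) := by
    unfold Knots.localCoord
    fun_prop
  exact ((continuous_squareFormV _ _ _).comp h).mul continuous_const

/-- A closed piece that misses p stays away from p and imposes no condition there; the finitely many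
others are joined one at a time. -/
lemma hasFDerivWithinAt_iUnion_of_isClosed {ι E F : Type*} [Finite ι]
    [NormedAddCommGroup E] [NormedSpace ℝ E] [NormedAddCommGroup F] [NormedSpace ℝ F]
    {R : ι → Set E} (hR : ∀ i, IsClosed (R i)) {g : E → F} {g' : E →L[ℝ] F} {p : E}
    (h : ∀ i, p ∈ R i → HasFDerivWithinAt g g' (R i) p) :
    HasFDerivWithinAt g g' (⋃ i, R i) p := by
  classical
  cases nonempty_fintype ι
  have key : ∀ t : Finset ι, HasFDerivWithinAt g g' (⋃ i ∈ t, R i) p := by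
    intro t
    induction t using Finset.induction_on with
    | empty => exact HasFDerivWithinAt.of_notMem_closure (by simp)
    | insert i t _ ih =>
      rw [Finset.set_biUnion_insert]
      refine HasFDerivWithinAt.union ?_ ih
      by_cases hp : p ∈ R i
      · exact h i hp
      · exact HasFDerivWithinAt.of_notMem_closure (by rwa [(hR i).closure_eq])
  simpa using key Finset.univ

lemma domain_eq_iUnion (X Y : Knots) : domain X Y =
    ⋃ i : Finset.Icc (1 : ℤ) X.m × Finset.Icc (1 : ℤ) Y.m, subrectangle X Y i.1 i.2 := by
  ext p
  rw [Set.mem_iUnion]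
  constructor
  · rintro ⟨h1, h2⟩
    exact ⟨(⟨_, (X.cell_mem h1).1⟩, ⟨_, (Y.cell_mem h2).1⟩), (X.cell_mem h1).2, (Y.cell_mem h2).2⟩
  · rintro ⟨i, h1, h2⟩
    exact ⟨X.subinterval_subset_segment _ h1, Y.subinterval_subset_segment _ h2⟩

lemma isClosed_subrectangle (X Y : Knots) (r s : ℤ) : IsClosed (subrectangle X Y r s) :=
  isClosed_Icc.prod isClosed_Icc

lemma hasFDerivWithinAt_spline (X Y : Knots) (φ : ℤ → ℤ → ℝ) (p : ℝ × ℝ) :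
    HasFDerivWithinAt (spline X Y φ) (splineFDeriv X Y φ p) (domain X Y) p := by
  rw [domain_eq_iUnion]
  refine hasFDerivWithinAt_iUnion_of_isClosed (fun i => isClosed_subrectangle X Y _ _)
    fun i hp => ?_
  obtain ⟨-, h2, h3⟩ := spline_eq_cellForm X Y φ i.1.2 i.2.2 hp
  rw [splineFDeriv, h2, h3]
  exact (hasFDerivAt_cellForm X Y φ i.1 i.2 p).hasFDerivWithinAt.congr
    (fun q hq => (spline_eq_cellForm X Y φ i.1.2 i.2.2 hq).1)
    (spline_eq_cellForm X Y φ i.1.2 i.2.2 hp).1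

lemma continuousOn_splineFDeriv (X Y : Knots) (φ : ℤ → ℤ → ℝ) :
    ContinuousOn (splineFDeriv X Y φ) (domain X Y) := by
  rw [domain_eq_iUnion]
  refine (locallyFinite_of_finite _).continuousOn_iUnion
    (fun i => isClosed_subrectangle X Y _ _) fun i => ?_
  have h : Continuous fun p =>
      cellGradX X Y φ i.1 i.2 p • ContinuousLinearMap.fst ℝ ℝ ℝ
        + cellGradY X Y φ i.1 i.2 p • ContinuousLinearMap.snd ℝ ℝ ℝ :=
    ((continuous_cellGradX X Y φ i.1 i.2).smul continuous_const).add
      ((continuous_cellGradY X Y φ i.1 i.2).smul continuous_const)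
  refine h.continuousOn.congr fun p hp => ?_
  obtain ⟨-, h2, h3⟩ := spline_eq_cellForm X Y φ i.1.2 i.2.2 hp
  rw [splineFDeriv, h2, h3]

lemma uniqueDiffOn_segment (X : Knots) : UniqueDiffOn ℝ X.segment :=
  uniqueDiffOn_Icc X.knot_zero_lt

lemma uniqueDiffOn_domain (X Y : Knots) : UniqueDiffOn ℝ (domain X Y) :=
  (uniqueDiffOn_segment X).prod (uniqueDiffOn_segment Y)

lemma contDiffOn_spline (X Y : Knots) (φ : ℤ → ℤ → ℝ) :
    ContDiffOn ℝ 1 (spline X Y φ) (domain X Y) := by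
  rw [show (1 : WithTop ℕ∞) = 0 + 1 from rfl,
    contDiffOn_succ_iff_hasFDerivWithinAt_of_uniqueDiffOn (uniqueDiffOn_domain X Y)]
  exact ⟨by simp, splineFDeriv X Y φ, contDiffOn_zero.2 (continuousOn_splineFDeriv X Y φ),
    fun p _ => hasFDerivWithinAt_spline X Y φ p⟩

/-! ### Divided differences of the coefficients -/

/-- The first partial derivative of a spline on a subrectangle is a convex combination of
divided differences of its coefficients. -/
lemma abs_cellGradX_sub_le (X Y : Knots) (φ : ℤ → ℤ → ℝ) {r s : ℤ}
    (hr : r ∈ Finset.Icc (1 : ℤ) X.m) (hs : s ∈ Finset.Icc (1 : ℤ) Y.m) {p : ℝ × ℝ}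
    (hp : p ∈ subrectangle X Y r s) {F E : ℝ}
    (h : ∀ i j, r ≤ i → i ≤ r + 1 → s - 1 ≤ j → j ≤ s + 1 →
      |φ i j - φ (i - 1) j - F * X.gap i| ≤ E * X.gap i) :
    |cellGradX X Y φ r s p - F| ≤ E := by
  have hr' := Finset.mem_Icc.1 hr
  have hs' := Finset.mem_Icc.1 hs
  have hpos := X.step_pos hr'.1 hr'.2
  -- Multiplying by `ratio'` replaces the gap by h_r / 2, which is the scale factor between the
  -- local coordinate and x; `hleft` does the same with `ratio`.
  have hright : ∀ j, s - 1 ≤ j → j ≤ s + 1 →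
      |X.ratio' (r + 1) * (φ (r + 1) j - φ r j) - F * (X.step r / 2)| ≤ E * (X.step r / 2) := by
    intro j h1 h2
    have h3 := h (r + 1) j (by omega) le_rfl h1 h2
    have h4 := X.ratio'_mul_gap (r + 1)
    rw [add_sub_cancel_right] at h3 h4
    rw [← h4, show X.ratio' (r + 1) * (φ (r + 1) j - φ r j)
        - F * (X.ratio' (r + 1) * X.gap (r + 1))
      = X.ratio' (r + 1) * (φ (r + 1) j - φ r j - F * X.gap (r + 1)) by ring, abs_mul,
      abs_of_nonneg (X.ratio'_nonneg _)]
    linarith [mul_le_mul_of_nonneg_left h3 (X.ratio'_nonneg (r + 1))]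
  have hleft : ∀ j, s - 1 ≤ j → j ≤ s + 1 →
      |X.ratio r * (φ r j - φ (r - 1) j) - F * (X.step r / 2)| ≤ E * (X.step r / 2) := by
    intro j h1 h2
    have h3 := h r j le_rfl (by omega) h1 h2
    rw [← X.ratio_mul_gap r, show X.ratio r * (φ r j - φ (r - 1) j)
        - F * (X.ratio r * X.gap r)
      = X.ratio r * (φ r j - φ (r - 1) j - F * X.gap r) by ring, abs_mul,
      abs_of_nonneg (X.ratio_nonneg _)]
    linarith [mul_le_mul_of_nonneg_left h3 (X.ratio_nonneg r)]
  -- A blend in y is a convex combination of two neighbouring values, so it inherits their common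
  -- bound.
  have hblend : ∀ b, ∀ ψ : ℤ → ℝ,
      (∀ j, s - 1 ≤ j → j ≤ s + 1 → |ψ j - F * (X.step r / 2)| ≤ E * (X.step r / 2)) →
      |Y.blend ψ (sideIndex s b) - F * (X.step r / 2)| ≤ E * (X.step r / 2) := by
    intro b ψ hψ
    have hb : s - 1 ≤ sideIndex s b ∧ sideIndex s b ≤ s := by
      cases b
      · rw [sideIndex_false]; omega
      · rw [sideIndex_true]; omega
    have h1 := abs_le.1 (hψ (sideIndex s b) (by omega) (by omega))
    have h2 := abs_le.1 (hψ (sideIndex s b + 1) (by omega) (by omega))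
    have h3 := Y.ratio_add_ratio' (i := sideIndex s b + 1) (by omega) (by omega)
    have h4 := Y.ratio_nonneg (sideIndex s b + 1)
    have h5 := Y.ratio'_nonneg (sideIndex s b + 1)
    rw [Knots.blend, show Y.ratio' (sideIndex s b + 1) = 1 - Y.ratio (sideIndex s b + 1) by
      linarith] at *
    rw [abs_le]
    constructor
    · nlinarith [mul_le_mul_of_nonneg_left h1.1 h4, mul_le_mul_of_nonneg_left h2.1 h5]
    · nlinarith [mul_le_mul_of_nonneg_left h1.2 h4, mul_le_mul_of_nonneg_left h2.2 h5]
  have key : |squareFormU (cornerCoef X Y φ r s) (vertCoef X φ r s) (horCoef Y φ r s)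
      (X.localCoord r p.1) (Y.localCoord s p.2) - F * (X.step r / 2)| ≤ E * (X.step r / 2) := by
    refine abs_squareFormU_sub_le (X.localCoord_mem hr hp.1) (Y.localCoord_mem hs hp.2) ?_ ?_ ?_
    · have h1 := abs_le.1 (hright s (by omega) (by omega))
      have h2 := abs_le.1 (hleft s (by omega) (by omega))
      have e1 := Knots.blend_sub (X := X) (k := r) (by omega) hr'.2 (fun i => φ i s)
      have e2 := Knots.sub_blend (X := X) (k := r - 1) (by omega) (by omega) (fun i => φ i s)
      simp only [sub_add_cancel] at e2
      rw [vertCoef, vertCoef, sideIndex_true, sideIndex_false, abs_le]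
      constructor <;> linarith
    · intro b
      rw [cornerCoef, horCoef, sideIndex_true, Knots.blend_sub (by omega) hr'.2,
        show X.ratio' (r + 1) * (Y.blend (φ (r + 1)) (sideIndex s b)
          - Y.blend (φ r) (sideIndex s b))
        = Y.blend (fun j => X.ratio' (r + 1) * (φ (r + 1) j - φ r j)) (sideIndex s b) by
          simp only [Knots.blend]; ring]
      exact hblend b _ hright
    · intro b
      have e2 := Knots.sub_blend (X := X) (k := r - 1) (by omega) (by omega)
        (fun i => Y.blend (φ i) (sideIndex s b))
      simp only [sub_add_cancel] at e2
      rw [cornerCoef, horCoef, sideIndex_false, e2,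
        show X.ratio r * (Y.blend (φ r) (sideIndex s b) - Y.blend (φ (r - 1)) (sideIndex s b))
        = Y.blend (fun j => X.ratio r * (φ r j - φ (r - 1) j)) (sideIndex s b) by
          simp only [Knots.blend]; ring]
      exact hblend b _ hleft
  rw [cellGradX]
  generalize squareFormU _ _ _ _ _ = G at key
  rw [show G * (2 / X.step r) - F = (G - F * (X.step r / 2)) * (2 / X.step r) by field_simp,
    abs_mul, abs_of_nonneg (a := 2 / X.step r) (by positivity)]
  calc _ ≤ E * (X.step r / 2) * (2 / X.step r) := by gcongr
    _ = E := by field_simp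

/-! ### Differences of the coefficient functionals -/

/-- The horizontal difference quotients of `f` near the subrectangle of indices `r`, `s` differ
from `F` by at most `K`. -/
def SlopeNear (X Y : Knots) (f : ℝ × ℝ → ℝ) (r s : ℤ) (F K : ℝ) : Prop :=
  ∀ a ∈ Set.Icc (X.knot (r - 3)) (X.knot (r + 2)), ∀ b ∈ Set.Icc (X.knot (r - 3)) (X.knot (r + 2)),
    ∀ y ∈ Set.Icc (Y.knot (s - 3)) (Y.knot (s + 2)), a ≤ b →
      |f (b, y) - f (a, y) - F * (b - a)| ≤ K * (b - a)

lemma Knots.knot_mem_Icc (X : Knots) {k a b : ℤ} (h1 : a ≤ k) (h2 : k ≤ b) :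
    X.knot k ∈ Set.Icc (X.knot a) (X.knot b) :=
  ⟨X.knot_mono h1, X.knot_mono h2⟩

lemma Knots.mid_mem_Icc (X : Knots) {k a b : ℤ} (h1 : a + 1 ≤ k) (h2 : k ≤ b) :
    X.mid k ∈ Set.Icc (X.knot a) (X.knot b) :=
  ⟨(X.knot_mono (by omega)).trans (X.knot_sub_one_le_mid k),
    (X.mid_le_knot k).trans (X.knot_mono h2)⟩

/-- The window of `SlopeNear` is just wide enough: the midpoints involved run from s_{r-2} ≥ x_{r-3}
to s_{r+2} ≤ x_{r+2}. Multiplying by the gap instead of dividing keeps the statement meaningful when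
repeated end knots make the gap vanish. -/
lemma SlopeNear.abs_mid_sub_le {X Y : Knots} {f : ℝ × ℝ → ℝ} {r s : ℤ} {F K : ℝ}
    (h : SlopeNear X Y f r s F K) {k l : ℤ} (h1 : r - 1 ≤ k) (h2 : k ≤ r + 2) (h3 : s - 2 ≤ l)
    (h4 : l ≤ s + 2) :
    |f (siteM X Y k l) - f (siteM X Y (k - 1) l) - F * X.gap k| ≤ K * X.gap k :=
  h _ (X.mid_mem_Icc (by omega) (by omega)) _ (X.mid_mem_Icc (by omega) (by omega)) _
    (Y.mid_mem_Icc (by omega) (by omega)) (X.mid_mono (by omega))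

/-- The vertices on the line x_{i-1} are common to both functionals and cancel, leaving two
differences over x_i - x_{i-2}, twice the gap, with weight 1/4. The factor is 2 + (1/4)(2 + 2) = 3.
-/
lemma SlopeNear.abs_muW_sub_le {X Y : Knots} {f : ℝ × ℝ → ℝ} {r s : ℤ} {F K : ℝ}
    (h : SlopeNear X Y f r s F K) {i j : ℤ} (h1 : r ≤ i) (h2 : i ≤ r + 1) (h3 : s - 1 ≤ j)
    (h4 : j ≤ s + 1) :
    |muW X Y f i j - muW X Y f (i - 1) j - F * X.gap i| ≤ 3 * K * X.gap i := by
  have hM := abs_le.1 (h.abs_mid_sub_le (k := i) (l := j) (by omega) (by omega) (by omega)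
    (by omega))
  have hA : ∀ l, s - 2 ≤ l → l ≤ s + 1 →
      |f (siteA X Y i l) - f (siteA X Y (i - 2) l) - F * (2 * X.gap i)| ≤ K * (2 * X.gap i) := by
    intro l h5 h6
    rw [← X.knot_sub_knot_sub_two i]
    exact h _ (X.knot_mem_Icc (by omega) (by omega)) _ (X.knot_mem_Icc (by omega) (by omega)) _
      (Y.knot_mem_Icc (by omega) (by omega)) (X.knot_mono (by omega))
  have hA1 := abs_le.1 (hA j (by omega) (by omega))
  have hA2 := abs_le.1 (hA (j - 1) (by omega) (by omega))
  unfold muW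
  rw [show i - 1 - 1 = i - 2 by ring, abs_le]
  constructor <;> linarith

lemma SlopeNear.abs_muS_sub_le {X Y : Knots} {f : ℝ × ℝ → ℝ} {r s : ℤ} {F K : ℝ}
    (h : SlopeNear X Y f r s F K) {i j : ℤ} (h1 : r ≤ i) (h2 : i ≤ r + 1) (h3 : s - 1 ≤ j)
    (h4 : j ≤ s + 1) :
    |muS X Y f i j - muS X Y f (i - 1) j - F * X.gap i| ≤ 9 * K * X.gap i := by
  have e0 := h.abs_mid_sub_le (k := i) (l := j) (by omega) (by omega) (by omega) (by omega)
  have e1 := h.abs_mid_sub_le (k := i) (l := j - 1) (by omega) (by omega) (by omega) (by omega)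
  have e2 := h.abs_mid_sub_le (k := i) (l := j + 1) (by omega) (by omega) (by omega) (by omega)
  have e3 := h.abs_mid_sub_le (k := i + 1) (l := j) (by omega) (by omega) (by omega) (by omega)
  have e4 := h.abs_mid_sub_le (k := i - 1) (l := j) (by omega) (by omega) (by omega) (by omega)
  have g1 := X.coefA_mul_gap i
  have g2 := X.coefA_mul_gap (i - 1)
  rw [sub_add_cancel] at g2
  rw [add_sub_cancel_right] at e3
  -- Each functional is f at its own midpoint plus multiples of differences to the neighbours, so
  -- everything regroups into errors of horizontal differences. The surplus multiples of F cancel by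
  -- `g1` and `g2`. The five terms contribute 3 + 1 + 1 + 2 + 2 = 9.
  have hdec : muS X Y f i j - muS X Y f (i - 1) j - F * X.gap i =
      (1 - X.coefA i - X.coefC (i - 1))
        * (f (siteM X Y i j) - f (siteM X Y (i - 1) j) - F * X.gap i)
      + X.coefC i * (f (siteM X Y (i + 1) j) - f (siteM X Y i j) - F * X.gap (i + 1))
      + X.coefA (i - 1)
        * (f (siteM X Y (i - 1) j) - f (siteM X Y (i - 1 - 1) j) - F * X.gap (i - 1))
      + Y.coefA j * ((f (siteM X Y i (j - 1)) - f (siteM X Y (i - 1) (j - 1)) - F * X.gap i)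
        - (f (siteM X Y i j) - f (siteM X Y (i - 1) j) - F * X.gap i))
      + Y.coefC j * ((f (siteM X Y i (j + 1)) - f (siteM X Y (i - 1) (j + 1)) - F * X.gap i)
        - (f (siteM X Y i j) - f (siteM X Y (i - 1) j) - F * X.gap i)) := by
    unfold muS
    rw [sub_add_cancel]
    linear_combination F * g2 - F * g1
  rw [hdec]
  generalize f (siteM X Y i j) - f (siteM X Y (i - 1) j) - F * X.gap i = d0 at *
  generalize f (siteM X Y i (j - 1)) - f (siteM X Y (i - 1) (j - 1)) - F * X.gap i = d1 at *
  generalize f (siteM X Y i (j + 1)) - f (siteM X Y (i - 1) (j + 1)) - F * X.gap i = d2 at *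
  generalize f (siteM X Y (i + 1) j) - f (siteM X Y i j) - F * X.gap (i + 1) = d3 at *
  generalize f (siteM X Y (i - 1) j) - f (siteM X Y (i - 1 - 1) j) - F * X.gap (i - 1) = d4 at *
  have hnonneg : 0 ≤ K * X.gap i := (abs_nonneg _).trans e0
  have a1 := X.abs_coefA_le_one i
  have a2 := X.abs_coefC_le_one (i - 1)
  have b0 : |(1 - X.coefA i - X.coefC (i - 1)) * d0| ≤ 3 * (K * X.gap i) := by
    rw [abs_mul]
    refine mul_le_mul ?_ e0 (abs_nonneg _) (by norm_num)
    rw [abs_le] at a1 a2 ⊢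
    constructor <;> linarith
  -- The error `d3` lives on the gap i + 1, which may be much larger than the gap i; `g1` trades one
  -- for the other, so no mesh ratio appears.
  have b3 : |X.coefC i * d3| ≤ K * X.gap i := by
    rw [abs_mul]
    calc |X.coefC i| * |d3| ≤ |X.coefC i| * (K * X.gap (i + 1)) := by gcongr
      _ = K * (|X.coefC i| * |X.gap (i + 1)|) := by
        rw [abs_of_nonneg (X.gap_nonneg (i + 1))]; ring
      _ = |X.coefA i| * (K * X.gap i) := by
        rw [← abs_mul, ← g1, abs_mul, abs_of_nonneg (X.gap_nonneg i)]; ring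
      _ ≤ 1 * (K * X.gap i) := by gcongr
      _ = K * X.gap i := one_mul _
  have b4 : |X.coefA (i - 1) * d4| ≤ K * X.gap i := by
    rw [abs_mul]
    calc |X.coefA (i - 1)| * |d4| ≤ |X.coefA (i - 1)| * (K * X.gap (i - 1)) := by gcongr
      _ = K * (|X.coefA (i - 1)| * |X.gap (i - 1)|) := by
        rw [abs_of_nonneg (X.gap_nonneg (i - 1))]; ring
      _ = |X.coefC (i - 1)| * (K * X.gap i) := by
        rw [← abs_mul, g2, abs_mul, abs_of_nonneg (X.gap_nonneg i)]; ring
      _ ≤ 1 * (K * X.gap i) := by gcongr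
      _ = K * X.gap i := one_mul _
  have b5 : ∀ c d, |c| ≤ 1 → |d| ≤ K * X.gap i → |c * (d - d0)| ≤ 2 * (K * X.gap i) := by
    intro c d hc hd
    rw [abs_mul]
    calc |c| * |d - d0| ≤ 1 * (K * X.gap i + K * X.gap i) :=
          mul_le_mul hc ((abs_sub _ _).trans (add_le_add hd e0)) (abs_nonneg _) zero_le_one
      _ = 2 * (K * X.gap i) := by ring
  have b1 := b5 _ _ (Y.abs_coefA_le_one j) e1
  have b2 := b5 _ _ (Y.abs_coefC_le_one j) e2
  rw [abs_le] at *
  constructor <;> linarith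

/-! ### Partial derivatives and moduli of continuity -/

lemma partialD_one_zero (X Y : Knots) (g : ℝ × ℝ → ℝ) (p : ℝ × ℝ) :
    partialD X Y (1, 0) g p = derivWithin (fun x => g (x, p.2)) X.segment p.1 := by
  simp only [partialD, iteratedDerivWithin_one, iteratedDerivWithin_zero]

lemma partialD_zero_one (X Y : Knots) (g : ℝ × ℝ → ℝ) (p : ℝ × ℝ) :
    partialD X Y (0, 1) g p = derivWithin (fun y => g (p.1, y)) Y.segment p.2 := by
  simp only [partialD, iteratedDerivWithin_one, iteratedDerivWithin_zero]

lemma hasDerivWithinAt_of_hasFDerivWithinAt {X Y : Knots} {g : ℝ × ℝ → ℝ} {L : ℝ × ℝ →L[ℝ] ℝ}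
    {p : ℝ × ℝ} (hp : p ∈ domain X Y) (h : HasFDerivWithinAt g L (domain X Y) p) :
    HasDerivWithinAt (fun x => g (x, p.2)) (L (1, 0)) X.segment p.1 := by
  have h1 : HasDerivWithinAt (fun x : ℝ => (x, p.2)) ((1 : ℝ), (0 : ℝ)) X.segment p.1 :=
    (hasDerivWithinAt_id _ _).prodMk (hasDerivWithinAt_const _ _ _)
  exact HasFDerivWithinAt.comp_hasDerivWithinAt (f := fun x : ℝ => (x, p.2)) p.1 h h1
    fun x hx => ⟨hx, hp.2⟩

lemma partialD_eq_of_hasFDerivWithinAt {X Y : Knots} {g : ℝ × ℝ → ℝ} {L : ℝ × ℝ →L[ℝ] ℝ}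
    {p : ℝ × ℝ} (hp : p ∈ domain X Y) (h : HasFDerivWithinAt g L (domain X Y) p) :
    partialD X Y (1, 0) g p = L (1, 0) := by
  rw [partialD_one_zero]
  exact (hasDerivWithinAt_of_hasFDerivWithinAt hp h).derivWithin (uniqueDiffOn_segment X _ hp.1)

lemma hasDerivWithinAt_partialD {X Y : Knots} {f : ℝ × ℝ → ℝ}
    (hf : ContDiffOn ℝ 1 f (domain X Y)) {p : ℝ × ℝ} (hp : p ∈ domain X Y) :
    HasDerivWithinAt (fun x => f (x, p.2)) (partialD X Y (1, 0) f p) X.segment p.1 := by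
  have h := (hf.differentiableOn one_ne_zero p hp).hasFDerivWithinAt
  rw [partialD_eq_of_hasFDerivWithinAt hp h]
  exact hasDerivWithinAt_of_hasFDerivWithinAt hp h

lemma continuousOn_partialD {X Y : Knots} {f : ℝ × ℝ → ℝ}
    (hf : ContDiffOn ℝ 1 f (domain X Y)) :
    ContinuousOn (partialD X Y (1, 0) f) (domain X Y) := by
  have h := hf.continuousOn_fderivWithin (uniqueDiffOn_domain X Y) le_rfl
  refine (h.clm_apply (continuousOn_const (c := ((1 : ℝ), (0 : ℝ))))).congr fun p hp => ?_
  exact partialD_eq_of_hasFDerivWithinAt hp (hf.differentiableOn one_ne_zero p hp).hasFDerivWithinAt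

/-- Compactness of the rectangle bounds the set of differences, without which the real supremum
would not dominate its elements. -/
lemma abs_sub_le_modulus {X Y : Knots} {ψ : ℝ × ℝ → ℝ} (hψ : ContinuousOn ψ (domain X Y))
    {t : ℝ} {M P : ℝ × ℝ} (hM : M ∈ domain X Y) (hP : P ∈ domain X Y)
    (h : Real.sqrt ((M.1 - P.1) ^ 2 + (M.2 - P.2) ^ 2) ≤ t) :
    |ψ M - ψ P| ≤ modulus X Y ψ t := by
  have hc : IsCompact (domain X Y) := isCompact_Icc.prod isCompact_Icc
  obtain ⟨B, hB⟩ := hc.exists_bound_of_continuousOn hψ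
  refine le_csSup ⟨B + B, ?_⟩ ⟨M, hM, P, hP, h, rfl⟩
  rintro d ⟨M, hM, P, hP, -, rfl⟩
  exact (abs_sub _ _).trans (add_le_add (hB M hM) (hB P hP))

lemma convex_domain (X Y : Knots) : Convex ℝ (domain X Y) :=
  (convex_Icc _ _).prod (convex_Icc _ _)

/-- The segment from P to M stays in the convex rectangle and splits into n pieces of length at most
t. The induction removes the piece next to P, of relative length 1/(n + 1). -/
lemma abs_sub_le_nat_mul_modulus {X Y : Knots} {ψ : ℝ × ℝ → ℝ}
    (hψ : ContinuousOn ψ (domain X Y)) {t : ℝ} (ht : 0 ≤ t) (n : ℕ) {M P : ℝ × ℝ}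
    (hM : M ∈ domain X Y) (hP : P ∈ domain X Y)
    (h : (M.1 - P.1) ^ 2 + (M.2 - P.2) ^ 2 ≤ (n * t) ^ 2) :
    |ψ M - ψ P| ≤ n * modulus X Y ψ t := by
  induction n generalizing P with
  | zero =>
    have h1 : M.1 = P.1 := by
      simp only [Nat.cast_zero, zero_mul] at h
      nlinarith [sq_nonneg (M.1 - P.1), sq_nonneg (M.2 - P.2)]
    have h2 : M.2 = P.2 := by
      simp only [Nat.cast_zero, zero_mul] at h
      nlinarith [sq_nonneg (M.1 - P.1), sq_nonneg (M.2 - P.2)]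
    rw [Prod.ext h1 h2]
    simp
  | succ n ih =>
    have hn : (0 : ℝ) < n + 1 := by positivity
    push_cast at h ⊢
    set c : ℝ := 1 / (n + 1) with hc
    have hc0 : 0 ≤ c := by positivity
    have hc1 : c ≤ 1 := by
      rw [hc, div_le_one hn]
      linarith [(Nat.cast_nonneg n : (0 : ℝ) ≤ n)]
    have hcn : c * (n + 1) = 1 := by rw [hc]; field_simp
    have hQ : P + c • (M - P) ∈ domain X Y :=
      (convex_domain X Y).add_smul_sub_mem hP hM ⟨hc0, hc1⟩
    set Q := P + c • (M - P) with hQdef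
    have q1 : Q.1 = P.1 + c * (M.1 - P.1) := rfl
    have q2 : Q.2 = P.2 + c * (M.2 - P.2) := rfl
    have e1 : |ψ M - ψ Q| ≤ n * modulus X Y ψ t := by
      refine ih hQ ?_
      calc (M.1 - Q.1) ^ 2 + (M.2 - Q.2) ^ 2
          = (1 - c) ^ 2 * ((M.1 - P.1) ^ 2 + (M.2 - P.2) ^ 2) := by rw [q1, q2]; ring
        _ ≤ (1 - c) ^ 2 * ((n + 1) * t) ^ 2 := by gcongr
        _ = (((n + 1) - c * (n + 1)) * t) ^ 2 := by ring
        _ = (n * t) ^ 2 := by rw [hcn]; ring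
    have e2 : |ψ Q - ψ P| ≤ modulus X Y ψ t := by
      refine abs_sub_le_modulus hψ hQ hP (Real.sqrt_le_iff.2 ⟨ht, ?_⟩)
      calc (Q.1 - P.1) ^ 2 + (Q.2 - P.2) ^ 2
          = c ^ 2 * ((M.1 - P.1) ^ 2 + (M.2 - P.2) ^ 2) := by rw [q1, q2]; ring
        _ ≤ c ^ 2 * ((n + 1) * t) ^ 2 := by gcongr
        _ = (c * (n + 1) * t) ^ 2 := by ring
        _ = t ^ 2 := by rw [hcn, one_mul]
    calc |ψ M - ψ P| ≤ |ψ M - ψ Q| + |ψ Q - ψ P| := abs_sub_le _ _ _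
      _ ≤ (n + 1) * modulus X Y ψ t := by linarith

lemma Knots.abs_sub_le_of_mem_Icc (X : Knots) {r : ℤ} {x t : ℝ}
    (hx : x ∈ Set.Icc (X.knot (r - 3)) (X.knot (r + 2))) (ht : t ∈ X.subinterval r) :
    |x - t| ≤ 3 * X.maxStep := by
  have h := X.step_le_maxStep
  have h1 := h (r - 2)
  have h2 := h (r - 1)
  have h3 := h r
  have h4 := h (r + 1)
  have h5 := h (r + 2)
  rw [Knots.step] at h1 h2 h3 h4 h5
  rw [show r - 2 - 1 = r - 3 by ring] at h1
  rw [show r - 1 - 1 = r - 2 by ring] at h2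
  rw [show r + 1 - 1 = r by ring] at h4
  rw [show r + 2 - 1 = r + 1 by ring] at h5
  rw [abs_le]
  constructor
  · linarith [hx.1, ht.2]
  · linarith [hx.2, ht.1]

lemma meshMin_pos (X Y : Knots) : 0 < meshMin X Y := lt_min X.minStep_pos Y.minStep_pos

lemma meshMin_le_meshMax (X Y : Knots) : meshMin X Y ≤ meshMax X Y :=
  (min_le_left _ _).trans (X.minStep_le_maxStep.trans (le_max_left _ _))

lemma meshMax_nonneg (X Y : Knots) : 0 ≤ meshMax X Y :=
  (meshMin_pos X Y).le.trans (meshMin_le_meshMax X Y)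

lemma modulus_le_modulusD (X Y : Knots) (f : ℝ × ℝ → ℝ) (t : ℝ) :
    modulus X Y (partialD X Y (1, 0) f) t ≤ modulusD X Y 1 f t :=
  Finset.le_sup' (f := fun α => modulus X Y (partialD X Y α f) t) (b := (1, 0)) (by simp)

lemma modulusD_nonneg {X Y : Knots} {f : ℝ × ℝ → ℝ} (hf : ContDiffOn ℝ 1 f (domain X Y))
    {t : ℝ} (ht : 0 ≤ t) : 0 ≤ modulusD X Y 1 f t := by
  have hp : (X.knot 0, Y.knot 0) ∈ domain X Y := ⟨X.knot_mem_segment 0, Y.knot_mem_segment 0⟩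
  refine le_trans ?_ (modulus_le_modulusD X Y f t)
  simpa using abs_sub_le_modulus (continuousOn_partialD hf) hp hp (t := t) (by simpa using ht)

lemma abs_partialD_sub_le {X Y : Knots} {f : ℝ × ℝ → ℝ} (hf : ContDiffOn ℝ 1 f (domain X Y))
    {r s : ℤ} {p q : ℝ × ℝ} (hp : p ∈ subrectangle X Y r s)
    (hq1 : q.1 ∈ Set.Icc (X.knot (r - 3)) (X.knot (r + 2)))
    (hq2 : q.2 ∈ Set.Icc (Y.knot (s - 3)) (Y.knot (s + 2))) :
    |partialD X Y (1, 0) f q - partialD X Y (1, 0) f p|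
      ≤ 9 * modulusD X Y 1 f (meshMax X Y / 2) := by
  have hpd : p ∈ domain X Y :=
    ⟨X.subinterval_subset_segment _ hp.1, Y.subinterval_subset_segment _ hp.2⟩
  have hqd : q ∈ domain X Y :=
    ⟨Set.Icc_subset_Icc (X.knot_mem_segment _).1 (X.knot_mem_segment _).2 hq1,
      Set.Icc_subset_Icc (Y.knot_mem_segment _).1 (Y.knot_mem_segment _).2 hq2⟩
  have h0 := meshMax_nonneg X Y
  have h1 : |q.1 - p.1| ≤ 3 * meshMax X Y :=
    (X.abs_sub_le_of_mem_Icc hq1 hp.1).trans (by gcongr; exact le_max_left _ _)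
  have h2 : |q.2 - p.2| ≤ 3 * meshMax X Y :=
    (Y.abs_sub_le_of_mem_Icc hq2 hp.2).trans (by gcongr; exact le_max_right _ _)
  -- Both coordinates differ by at most 3h, and 9h² + 9h² = 18h² ≤ (9h/2)²; nine is the least
  -- integer for which this works.
  have h3 := abs_sub_le_nat_mul_modulus (continuousOn_partialD hf)
    (t := meshMax X Y / 2) (by positivity) 9 hqd hpd (by
      have e1 := sq_le_sq' (abs_le.1 h1).1 (abs_le.1 h1).2
      have e2 := sq_le_sq' (abs_le.1 h2).1 (abs_le.1 h2).2
      push_cast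
      nlinarith)
  refine h3.trans ?_
  push_cast
  gcongr
  exact modulus_le_modulusD X Y f _

/-- Mean value inequality for x ↦ f(x, y) - F x, whose derivative is the variation of the
x-derivative of f from its value F at p. -/
lemma slopeNear_partialD {X Y : Knots} {f : ℝ × ℝ → ℝ} (hf : ContDiffOn ℝ 1 f (domain X Y))
    {r s : ℤ} {p : ℝ × ℝ} (hp : p ∈ subrectangle X Y r s) :
    SlopeNear X Y f r s (partialD X Y (1, 0) f p)
      (9 * modulusD X Y 1 f (meshMax X Y / 2)) := by
  intro a ha b hb y hy hab
  have hy' : y ∈ Y.segment :=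
    Set.Icc_subset_Icc (Y.knot_mem_segment _).1 (Y.knot_mem_segment _).2 hy
  set I := Set.Icc (X.knot (r - 3)) (X.knot (r + 2)) with hI
  have hsub : I ⊆ X.segment :=
    Set.Icc_subset_Icc (X.knot_mem_segment _).1 (X.knot_mem_segment _).2
  have hd : ∀ x ∈ I, HasDerivWithinAt (fun x => f (x, y) - partialD X Y (1, 0) f p * x)
      (partialD X Y (1, 0) f (x, y) - partialD X Y (1, 0) f p) I x := fun x hx => by
    have h1 := (hasDerivWithinAt_partialD hf (p := (x, y)) ⟨hsub hx, hy'⟩).mono hsub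
    have h2 := (hasDerivWithinAt_id x I).const_mul (partialD X Y (1, 0) f p)
    rw [mul_one] at h2
    exact h1.sub h2
  have h := (convex_Icc _ _).norm_image_sub_le_of_norm_hasDerivWithin_le hd
    (fun x hx => abs_partialD_sub_le hf hp hx hy) ha hb
  simp only [Real.norm_eq_abs] at h
  rw [abs_of_nonneg (sub_nonneg.2 hab)] at h
  convert h using 2
  ring

lemma abs_partialD_sub_spline_le {X Y : Knots} {f : ℝ × ℝ → ℝ}
    (hf : ContDiffOn ℝ 1 f (domain X Y)) {φ : ℤ → ℤ → ℝ} {c : ℝ}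
    (hφ : ∀ (r s : ℤ) (F K : ℝ), SlopeNear X Y f r s F K → ∀ i j, r ≤ i → i ≤ r + 1 →
      s - 1 ≤ j → j ≤ s + 1 → |φ i j - φ (i - 1) j - F * X.gap i| ≤ c * K * X.gap i)
    {p : ℝ × ℝ} (hp : p ∈ domain X Y) :
    |partialD X Y (1, 0) f p - partialD X Y (1, 0) (spline X Y φ) p|
      ≤ c * (9 * modulusD X Y 1 f (meshMax X Y / 2)) := by
  obtain ⟨hr, h1⟩ := X.cell_mem hp.1
  obtain ⟨hs, h2⟩ := Y.cell_mem hp.2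
  have h3 := partialD_eq_of_hasFDerivWithinAt hp (hasFDerivWithinAt_spline X Y φ p)
  have h4 : splineFDeriv X Y φ p (1, 0) = cellGradX X Y φ (X.cell p.1) (Y.cell p.2) p := by
    simp [splineFDeriv, splineGradX]
  rw [h3, h4, abs_sub_comm]
  exact abs_cellGradX_sub_le X Y φ hr hs ⟨h1, h2⟩ fun i j i1 i2 j1 j2 =>
    hφ _ _ _ _ (slopeNear_partialD hf ⟨h1, h2⟩) i j i1 i2 j1 j2

/-! ### Exchange of the coordinates -/

lemma bspline_swap (X Y : Knots) (i j : ℤ) (p : ℝ × ℝ) :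
    bspline Y X j i p.swap = bspline X Y i j p := by
  simp only [bspline, bsplineCell_eq_squareForm, Prod.fst_swap, Prod.snd_swap]
  rw [← squareForm_swap]
  congr 1
  · ext b b'; ring
  · ext b; ring
  · ext b; ring

lemma spline_swap (X Y : Knots) (φ : ℤ → ℤ → ℝ) :
    spline Y X (fun j i => φ i j) = spline X Y φ ∘ Prod.swap := by
  ext p
  simp only [spline, Function.comp_apply, ← bspline_swap Y X]
  rw [Finset.sum_comm]

lemma partialD_swap (X Y : Knots) (g : ℝ × ℝ → ℝ) (p : ℝ × ℝ) :
    partialD X Y (0, 1) g p = partialD Y X (1, 0) (g ∘ Prod.swap) p.swap := by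
  rw [partialD_zero_one, partialD_one_zero]
  rfl

lemma modulus_swap (X Y : Knots) (ψ : ℝ × ℝ → ℝ) (t : ℝ) :
    modulus Y X (ψ ∘ Prod.swap) t = modulus X Y ψ t := by
  unfold modulus
  congr 1
  ext d
  constructor <;>
  · rintro ⟨M, hM, P, hP, h, rfl⟩
    exact ⟨M.swap, ⟨hM.2, hM.1⟩, P.swap, ⟨hP.2, hP.1⟩, by rwa [add_comm] at h, by simp⟩

lemma modulusD_one (X Y : Knots) (f : ℝ × ℝ → ℝ) (t : ℝ) :
    modulusD X Y 1 f t = max (modulus X Y (partialD X Y (1, 0) f) t)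
      (modulus X Y (partialD X Y (0, 1) f) t) := by
  refine le_antisymm (Finset.sup'_le _ _ ?_) (max_le (modulus_le_modulusD X Y f t)
    (Finset.le_sup' (f := fun α => modulus X Y (partialD X Y α f) t) (b := (0, 1)) (by simp)))
  rintro ⟨a, b⟩ h
  rw [Finset.HasAntidiagonal.mem_antidiagonal] at h
  rcases Nat.add_eq_one_iff.1 h with ⟨h1, h2⟩ | ⟨h1, h2⟩ <;> simp only at h1 h2 <;> subst h1 h2
  · exact le_max_right _ _
  · exact le_max_left _ _

lemma modulusD_swap (X Y : Knots) (f : ℝ × ℝ → ℝ) (t : ℝ) :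
    modulusD Y X 1 (f ∘ Prod.swap) t = modulusD X Y 1 f t := by
  have h1 : partialD X Y (0, 1) f = partialD Y X (1, 0) (f ∘ Prod.swap) ∘ Prod.swap :=
    funext fun p => partialD_swap X Y f p
  have h2 : partialD Y X (0, 1) (f ∘ Prod.swap) = partialD X Y (1, 0) f ∘ Prod.swap :=
    funext fun p => partialD_swap Y X _ p
  rw [modulusD_one, modulusD_one, h1, h2, modulus_swap, modulus_swap, max_comm]

lemma meshMax_comm (X Y : Knots) : meshMax Y X = meshMax X Y := max_comm _ _

lemma muS_swap (X Y : Knots) (f : ℝ × ℝ → ℝ) :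
    muS Y X (f ∘ Prod.swap) = fun j i => muS X Y f i j := by
  ext j i
  simp only [muS, siteM, Function.comp_apply, Prod.swap_prod_mk]
  ring

lemma muW_swap (X Y : Knots) (f : ℝ × ℝ → ℝ) :
    muW Y X (f ∘ Prod.swap) = fun j i => muW X Y f i j := by
  ext j i
  simp only [muW, siteM, siteA, Function.comp_apply, Prod.swap_prod_mk]
  ring

/-- A quasi-interpolation operator treating both coordinates alike, whose coefficients have
divided differences close to the derivatives of `f`, satisfies the error bound. -/
lemma firstDerivativeBound_spline {μ : Knots → Knots → (ℝ × ℝ → ℝ) → ℤ → ℤ → ℝ} {c C : ℝ}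
    (hC : 0 ≤ C) (hcC : 9 * c ≤ 1 + C)
    (hswap : ∀ X Y f, μ Y X (f ∘ Prod.swap) = fun j i => μ X Y f i j)
    (hμ : ∀ (X Y : Knots) (f : ℝ × ℝ → ℝ) (r s : ℤ) (F K : ℝ), SlopeNear X Y f r s F K →
      ∀ i j, r ≤ i → i ≤ r + 1 → s - 1 ≤ j → j ≤ s + 1 →
        |μ X Y f i j - μ X Y f (i - 1) j - F * X.gap i| ≤ c * K * X.gap i) :
    FirstDerivativeBound (fun X Y f => spline X Y (μ X Y f)) C := by
  intro X Y f hf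
  refine ⟨contDiffOn_spline X Y _, ?_⟩
  have hω := modulusD_nonneg hf (t := meshMax X Y / 2)
    (div_nonneg (meshMax_nonneg X Y) zero_le_two)
  have hratio : 1 ≤ meshMax X Y / meshMin X Y :=
    (one_le_div (meshMin_pos X Y)).2 (meshMin_le_meshMax X Y)
  -- The only use of the mesh ratio: 9c ≤ 1 + C ≤ 1 + C h/δ.
  have hconst : c * (9 * modulusD X Y 1 f (meshMax X Y / 2)) ≤
      (1 + C * (meshMax X Y / meshMin X Y)) * modulusD X Y 1 f (meshMax X Y / 2) := by
    rw [← mul_assoc]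
    refine mul_le_mul_of_nonneg_right ?_ hω
    nlinarith
  rintro ⟨a, b⟩ h p hp
  rcases Nat.add_eq_one_iff.1 h with ⟨h1, h2⟩ | ⟨h1, h2⟩ <;> simp only at h1 h2 <;> subst h1 h2
  · have hf' : ContDiffOn ℝ 1 (f ∘ Prod.swap) (domain Y X) :=
      hf.comp (contDiff_snd.prodMk contDiff_fst).contDiffOn fun q hq => ⟨hq.2, hq.1⟩
    have h1 := abs_partialD_sub_spline_le hf' (hμ Y X (f ∘ Prod.swap)) (p := p.swap)
      ⟨hp.2, hp.1⟩
    rw [hswap, spline_swap, ← partialD_swap, ← partialD_swap, modulusD_swap, meshMax_comm] at h1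
    exact h1.trans hconst
  · exact (abs_partialD_sub_spline_le hf (hμ X Y f) hp).trans hconst

end CrissCross

end

theorem theorem4 :
    (∃ C : ℝ, 0 < C ∧ C ≤ 120 ∧ CrissCross.FirstDerivativeBound CrissCross.opS C) ∧
    (∃ C : ℝ, 0 < C ∧ C ≤ 70 ∧ CrissCross.FirstDerivativeBound CrissCross.opW C) :=
  -- The constants are 80 = 9 · 9 - 1 and 26 = 9 · 3 - 1. The operators unfold to `spline` with
  -- coefficients `muS` and `muW`.
  ⟨⟨80, by norm_num, by norm_num,
    CrissCross.firstDerivativeBound_spline (μ := CrissCross.muS) (c := 9) (by norm_num)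
      (by norm_num) CrissCross.muS_swap
      fun _ _ _ _ _ _ _ h _ _ i1 i2 j1 j2 => h.abs_muS_sub_le i1 i2 j1 j2⟩,
  ⟨26, by norm_num, by norm_num,
    CrissCross.firstDerivativeBound_spline (μ := CrissCross.muW) (c := 3) (by norm_num)
      (by norm_num) CrissCross.muW_swap
      fun _ _ _ _ _ _ _ h _ _ i1 i2 j1 j2 => h.abs_muW_sub_le i1 i2 j1 j2⟩⟩
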